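/- Let $\{X_t\}_{t\in\mathbb Z}$ be a strictly stationary Gaussian time series with values in $\mathbb R^m$ and autocovariances $\gamma_{jk}(h)=\operatorname{Cov}(X_{t+h,j},X_{t,k})$. Suppose that the series $$f_{jk}(w)=\frac1{2\pi}\sum_{h\in\mathbb Z}e^{-iwh}\gamma_{jk}(h),\qquad 1\le j,k\le m,$$ converge absolutely and that every $f_{jk}$ is four times continuously differentiable on $\mathbb R$. For observations $X_1,\dots,X_n$ with sample mean $\bar X$, let $$\hat\gamma_{jk}(h)=\frac1n\sum_{t:\,1\le t\le n,\ 1\le t+h\le n}(X_{t+h,j}-\bar X_j)(X_{t,k}-\bar X_k),\qquad I_{jk}(w)=\frac1{2\pi}\sum_{|h|<n}e^{-iwh}\hat\gamma_{jk}(h).$$ Let $K:[0,1]\to[0,\infty)$ be a kernel of bounded variation with $\int_0^1K>0$, and put $K_{(s)}=\int_0^1K(u)u^s\,du$, $\widetilde K_{(s)}=\int_0^1K(u)^2u^s\,du$ and $K_\delta(x)=(2\pi\delta)^{-1}K(x/(2\pi\delta))$. Fix $\theta\in\{0,\pi,-\pi\}$ and $1\le j,k\le m$. For a bandwidth fraction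 $\delta$ let $M=\lfloor\delta n\rfloor$ and let $w_s=2\pi s/n$, where $s$ runs over $1,\dots,M$ if $\theta=0$, and over $\lfloor n/2\rfloor-M+1,\dots,\lfloor n/2\rfloor$ if $\theta=\pm\pi$. Let $\mathbf X$ be the $M\times2$ matrix with rows $(1,(|\theta|-w_s)^2)$, let $\mathbf W$ be the diagonal matrix with entries $K_\delta(\,|\,|\theta|-w_s|\,)$, let $\mathbf Y$ be the vector with entries $\operatorname{Re}I_{jk}(w_s)$, and let $$\tilde f_{jk}(\theta)=[1,0]\,(\mathbf X'\mathbf W\mathbf X)^{-1}\mathbf X'\mathbf W\mathbf Y$$ be the weighted least squares (WLS) local quadratic estimator of $f_{jk}(\theta)$ (where $\mathbf X'\mathbf W\mathbf X$ is singular, which does not happen for large $n$ below, $\tilde f_{jk}(\theta)$ is set to $0$). Let $\delta=\delta_n\to0$ with $\delta n\to\infty$ as $n\to\infty$. Then $\tilde f_{jk}(\theta)$ has a finite second moment, $$\operatorname{Var}[\tilde f_{jk}(\theta)]=\delta^{-1}n^{-1}\,\frac{f_{jk}(\theta)^2+f_{kj}(\theta)^2+2f_{jj}(\theta)f_{kk}(\theta)}{4}\cdot\frac{K_{(4)}^2\widetilde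 K_{(0)}-2K_{(4)}K_{(2)}\widetilde K_{(2)}+K_{(2)}^2\widetilde K_{(4)}}{(K_{(0)}K_{(4)}-K_{(2)}^2)^2}+O(\delta^{-2}n^{-2})+o(n^{-1}),$$ and $$\mathbb E[\tilde f_{jk}(\theta)]-f_{jk}(\theta)=\frac{(\operatorname{Re}f_{jk})^{(4)}(\theta)}{24}(2\pi\delta)^4\,\frac{K_{(4)}^2-K_{(6)}K_{(2)}}{K_{(4)}K_{(0)}-K_{(2)}^2}+o(\delta^4)+O(n^{-1}).$$ -/

import Mathlib

open MeasureTheory ProbabilityTheory Filter Asymptotics Topology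

noncomputable section

namespace LocalQuadratic

variable {Ω : Type*} [MeasurableSpace Ω] {m : ℕ}

/-- Strict stationarity of a vector-valued series: all finite-dimensional distributions are
invariant under time shifts. -/
def IsStrictlyStationary (X : ℤ → Ω → Fin m → ℝ) (P : Measure Ω) : Prop :=
  ∀ (k : ℤ) (S : Finset ℤ),
    IdentDistrib (fun ω (t : S) => X ((t : ℤ) + k) ω) (fun ω (t : S) => X (t : ℤ) ω) P P

/-- The autocovariance `γ_{jk}(h) = Cov(X_{t+h,j}, X_{t,k})` of a stationary series, taken at
`t = 0`. -/
def autocov (X : ℤ → Ω → Fin m → ℝ) (P : Measure Ω) (j k : Fin m) (h : ℤ) : ℝ :=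
  cov[fun ω => X h ω j, fun ω => X 0 ω k; P]

/-- The spectral density matrix `f(w) = (2π)⁻¹ ∑_{h ∈ ℤ} e^{-iwh} γ(h)`. -/
def specDensity (X : ℤ → Ω → Fin m → ℝ) (P : Measure Ω) (w : ℝ) : Matrix (Fin m) (Fin m) ℂ :=
  Matrix.of fun j k =>
    (2 * (Real.pi : ℂ))⁻¹ *
      ∑' h : ℤ, Complex.exp (-Complex.I * (w : ℂ) * (h : ℂ)) * (autocov X P j k h : ℂ)

/-- The smoothness assumption of order `p`: the series that defines the spectral density matrix
converges (unconditionally, equivalently absolutely), and each entry of the spectral density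
matrix is `p` times continuously differentiable on the real line. -/
def AssumptionA (X : ℤ → Ω → Fin m → ℝ) (P : Measure Ω) (p : ℕ) : Prop :=
  ∀ j k : Fin m, Summable (autocov X P j k) ∧
    ContDiff ℝ p (fun w : ℝ => specDensity X P w j k)

/-- The sample mean of `X_1, …, X_n`. -/
def sampleMean (X : ℤ → Ω → Fin m → ℝ) (n : ℕ) (ω : Ω) (j : Fin m) : ℝ :=
  (n : ℝ)⁻¹ * ∑ t ∈ Finset.Icc (1 : ℤ) n, X t ω j

/-- The sample autocovariance at lag `h` (of either sign):
`n⁻¹ ∑ (X_{t+h,j} - X̄_j) (X_{t,k} - X̄_k)`, the sum running over all `t` such that both `t` and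
`t + h` lie in `{1, …, n}`. It vanishes when `|h| ≥ n`, and it satisfies `γ̂(-h) = γ̂(h)ᵀ`. -/
def sampleAutocov (X : ℤ → Ω → Fin m → ℝ) (n : ℕ) (ω : Ω) (j k : Fin m) (h : ℤ) : ℝ :=
  (n : ℝ)⁻¹ * ∑ t ∈ (Finset.Icc (1 : ℤ) n).filter (fun t => t + h ∈ Finset.Icc (1 : ℤ) n),
    (X (t + h) ω j - sampleMean X n ω j) * (X t ω k - sampleMean X n ω k)

/-- The periodogram matrix `I(w) = (2π)⁻¹ ∑_h e^{-iwh} γ̂(h)`; the terms with `|h| ≥ n` vanish. -/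
def periodogram (X : ℤ → Ω → Fin m → ℝ) (n : ℕ) (ω : Ω) (w : ℝ) : Matrix (Fin m) (Fin m) ℂ :=
  Matrix.of fun j k =>
    (2 * (Real.pi : ℂ))⁻¹ *
      ∑ h ∈ Finset.Ioo (-(n : ℤ)) (n : ℤ),
        Complex.exp (-Complex.I * (w : ℂ) * (h : ℂ)) * (sampleAutocov X n ω j k h : ℂ)

/-- The number `M = [δ n]` of Fourier frequencies used in the regression. -/
def numFreq (δ : ℝ) (n : ℕ) : ℕ := ⌊δ * n⌋₊

/-- The Fourier frequencies `w_s = 2πs/n` used in the regression at the boundary point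
`θ ∈ {0, π, -π}`, enumerated by `i = 0, …, M - 1`: for `θ = 0` they are those with
`s = 1, …, M`; for `θ = ±π` they are those with `s = [n/2], [n/2] - 1, …, [n/2] - M + 1`. -/
def regFreq (θ : ℝ) (n : ℕ) (i : ℕ) : ℝ :=
  2 * Real.pi * (if θ = 0 then (i : ℝ) + 1 else ((n / 2 : ℕ) : ℝ) - (i : ℝ)) / (n : ℝ)

/-- The distance from the boundary point to the `i`-th frequency used. All frequencies used lie in
`[0, π]`, and the point `-π` is treated as the point `π`. -/
def regDist (θ : ℝ) (n : ℕ) (i : ℕ) : ℝ := |(|θ| - regFreq θ n i)|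

/-- The rescaled kernel `K_δ(x) = (2πδ)⁻¹ K(x / (2πδ))`. -/
def scaledKernel (K : ℝ → ℝ) (δ x : ℝ) : ℝ :=
  (2 * Real.pi * δ)⁻¹ * K (x / (2 * Real.pi * δ))

/-- The design matrix: a column of ones and a column of squared distances `(θ - w_s)²`. -/
def designMatrix (θ δ : ℝ) (n : ℕ) : Matrix (Fin (numFreq δ n)) (Fin 2) ℝ :=
  Matrix.of fun i => ![1, regDist θ n i ^ 2]

/-- The diagonal matrix of the regression weights `K_δ(|θ - w_s|)`. -/
def weightMatrix (K : ℝ → ℝ) (θ δ : ℝ) (n : ℕ) :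
    Matrix (Fin (numFreq δ n)) (Fin (numFreq δ n)) ℝ :=
  Matrix.diagonal fun i => scaledKernel K δ (regDist θ n i)

/-- The response vector: the real parts of the `(j, k)` periodogram ordinates. -/
def response (X : ℤ → Ω → Fin m → ℝ) (θ δ : ℝ) (n : ℕ) (j k : Fin m) (ω : Ω) :
    Fin (numFreq δ n) → ℝ :=
  fun i => (periodogram X n ω (regFreq θ n i) j k).re

/-- The weighted least squares local quadratic estimator of `f_{jk}(θ)`: the intercept
`[1, 0] (XᵀWX)⁻¹ XᵀWY` of the weighted regression. -/
def wlsEstimator (X : ℤ → Ω → Fin m → ℝ) (K : ℝ → ℝ) (θ δ : ℝ) (n : ℕ) (j k : Fin m)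
    (ω : Ω) : ℝ :=
  ![1, 0] ⬝ᵥ
    (((designMatrix θ δ n).transpose * weightMatrix K θ δ n * designMatrix θ δ n)⁻¹ *
      (designMatrix θ δ n).transpose * weightMatrix K θ δ n).mulVec (response X θ δ n j k ω)

/-- The kernel moments `K_{(s)} = ∫₀¹ K(u) uˢ du`. -/
def kernelMoment (K : ℝ → ℝ) (s : ℕ) : ℝ := ∫ u in (0 : ℝ)..1, K u * u ^ s

/-- The squared-kernel moments `∫₀¹ K(u)² uˢ du`. -/
def kernelSqMoment (K : ℝ → ℝ) (s : ℕ) : ℝ := ∫ u in (0 : ℝ)..1, K u ^ 2 * u ^ s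

/-- The constant `(K₍₄₎² - K₍₆₎ K₍₂₎) / (K₍₄₎ K₍₀₎ - K₍₂₎²)` in the bias. -/
def biasConst (K : ℝ → ℝ) : ℝ :=
  (kernelMoment K 4 ^ 2 - kernelMoment K 6 * kernelMoment K 2) /
    (kernelMoment K 4 * kernelMoment K 0 - kernelMoment K 2 ^ 2)

/-- The ratio of kernel moments in the variance. -/
def varConst (K : ℝ → ℝ) : ℝ :=
  (kernelMoment K 4 ^ 2 * kernelSqMoment K 0
      - 2 * kernelMoment K 4 * kernelMoment K 2 * kernelSqMoment K 2
      + kernelMoment K 2 ^ 2 * kernelSqMoment K 4) /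
    (kernelMoment K 0 * kernelMoment K 4 - kernelMoment K 2 ^ 2) ^ 2

end LocalQuadratic

end

/-! The estimator is linear in the periodogram. Put N = δn and let u_i = (i + c)/N be the rescaled
distances, with an offset c in [0, 1]. Cramer's rule for the 2×2 normal equations writes the
estimator as ∑ ω_i Re I(w_i) with explicit weights (`wlsEstimator_eq_sum`). Riemann sums of
functions of bounded variation have error O(1/N), hence |ω_i| = O(1/N), N ∑ ω_i² = `varConst` +
O(1/N) and ∑ ω_i u_i⁴ = `biasConst` + O(1/N) (`wlsWeight_asymptotics`). Once the determinant is
nonzero, ∑ ω_i = 1 and ∑ ω_i u_i² = 0 hold exactly.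

Smoothness of f makes ∑ |h| |γ(h)| finite (`summable_abs_mul_of_contDiff`), so Toeplitz forms at
Fourier frequencies equal their limiting values up to a bounded error (`norm_toeplitz_sub_le`). The
sample mean drops out at these frequencies. Therefore E Re I(w_s) = Re f(w_s) + O(1/n). Isserlis'
formula gives covariance O(n⁻²) for two different ordinates and variance V(w_s) + O(1/n) for one
ordinate, with V = `asympVar`. The exception is the frequency π itself: a single ordinate, whose
variance is merely bounded.

As γ is real, f(θ - x) is the conjugate of f(θ + x) for θ = 0, ±π, so Re f and V are even about θ.
Bias: the Taylor polynomial of Re f has only terms in x² and x⁴ besides the constant; the weights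
annihilate the first and the second gives the leading term. Variance: V(w_i) - V(θ) = o(δ), so the
diagonal contributes V(θ) `varConst`/N + O(N⁻²) + o(δ/N), where δ/N = 1/n, and the off-diagonal
terms add only O(n⁻²). -/

namespace LocalQuadratic

/-! ### Riemann sums of functions of bounded variation -/

section RiemannSums

/-- On a cell of length 1/N the sampled value and the integrand differ by at most the increment of G
over the cell, and for monotone G these increments telescope. N need not be an integer; the sample
point has the same relative position c in every cell. -/
lemma riemannSum_monotoneOn {G : ℝ → ℝ} (hG : MonotoneOn G (Set.Icc 0 1)) {N c : ℝ} (hN : 0 < N)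
    (hc0 : 0 ≤ c) (hc1 : c ≤ 1) :
    |N⁻¹ * ∑ i ∈ Finset.range ⌊N⌋₊, G ((i + c) / N) - ∫ u in (0 : ℝ)..1, G u| ≤
      (G 1 - G 0 + (|G 0| + |G 1|)) * N⁻¹ := by
  set M := ⌊N⌋₊ with hM
  have hMN : (M : ℝ) ≤ N := Nat.floor_le hN.le
  have hMN1 : (M : ℝ) / N ≤ 1 := (div_le_one hN).2 hMN
  have hM0 : 0 ≤ (M : ℝ) / N := by positivity
  have hint : ∀ a b : ℝ, a ∈ Set.Icc (0 : ℝ) 1 → b ∈ Set.Icc (0 : ℝ) 1 →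
      IntervalIntegrable G volume a b := fun a b ha hb =>
    (hG.mono (Set.uIcc_subset_Icc ha hb)).intervalIntegrable
  have hmem : ∀ i : ℕ, i ≤ M → (i : ℝ) / N ∈ Set.Icc (0 : ℝ) 1 := fun i hi =>
    ⟨by positivity, (div_le_one hN).2 (le_trans (by exact_mod_cast hi) hMN)⟩
  have hsum : ∑ i ∈ Finset.range M, ∫ u in ((i : ℝ) / N)..(((i + 1 : ℕ) : ℝ) / N), G u =
      ∫ u in (0 : ℝ)..(M / N), G u := by
    have := intervalIntegral.sum_integral_adjacent_intervals (μ := volume) (f := G)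
      (a := fun i : ℕ => (i : ℝ) / N) (n := M)
      (fun i hi => hint _ _ (hmem i hi.le) (hmem (i + 1) hi))
    simpa using this
  have hsplit : ∫ u in (0 : ℝ)..1, G u =
      (∫ u in (0 : ℝ)..(M / N), G u) + ∫ u in ((M : ℝ) / N)..1, G u :=
    (intervalIntegral.integral_add_adjacent_intervals
      (hint _ _ (by simp) (hmem M le_rfl)) (hint _ _ (hmem M le_rfl) (by simp))).symm
  have hcell : ∀ i ∈ Finset.range M,
      |N⁻¹ * G ((i + c) / N) - ∫ u in ((i : ℝ) / N)..(((i + 1 : ℕ) : ℝ) / N), G u| ≤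
        (G (((i + 1 : ℕ) : ℝ) / N) - G ((i : ℝ) / N)) * N⁻¹ := by
    intro i hi
    have hi' := Finset.mem_range.1 hi
    have h0 := hmem i hi'.le
    have h1 := hmem (i + 1) hi'
    have hle : (i : ℝ) / N ≤ ((i + 1 : ℕ) : ℝ) / N := by gcongr; simp
    have hlen : ((i + 1 : ℕ) : ℝ) / N - (i : ℝ) / N = N⁻¹ := by push_cast; field_simp; ring
    have hu0 : (i : ℝ) / N ≤ (i + c) / N := by gcongr; linarith
    have hu1 : (i + c) / N ≤ ((i + 1 : ℕ) : ℝ) / N := by gcongr; push_cast; linarith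
    have hu : (i + c) / N ∈ Set.Icc (0 : ℝ) 1 := ⟨h0.1.trans hu0, hu1.trans h1.2⟩
    have heq : N⁻¹ * G ((i + c) / N) - ∫ u in ((i : ℝ) / N)..(((i + 1 : ℕ) : ℝ) / N), G u =
        ∫ u in ((i : ℝ) / N)..(((i + 1 : ℕ) : ℝ) / N), (G ((i + c) / N) - G u) := by
      rw [intervalIntegral.integral_sub (by simp) (hint _ _ h0 h1),
        intervalIntegral.integral_const, hlen, smul_eq_mul]
    rw [heq]
    have := intervalIntegral.norm_integral_le_of_norm_le_const
      (a := (i : ℝ) / N) (b := ((i + 1 : ℕ) : ℝ) / N) (f := fun u => G ((i + c) / N) - G u)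
      (C := G (((i + 1 : ℕ) : ℝ) / N) - G ((i : ℝ) / N)) (by
        intro x hx
        rw [Set.uIoc_of_le hle] at hx
        have hx' : x ∈ Set.Icc (0 : ℝ) 1 := ⟨h0.1.trans hx.1.le, hx.2.trans h1.2⟩
        have a1 := hG h0 hx' hx.1.le
        have a2 := hG hx' h1 hx.2
        have a3 := hG h0 hu hu0
        have a4 := hG hu h1 hu1
        rw [Real.norm_eq_abs, abs_le]
        constructor <;> linarith)
    rwa [hlen, abs_of_pos (inv_pos.2 hN), Real.norm_eq_abs] at this
  -- The floor leaves an interval of length at most 1/N uncovered; monotonicity bounds |G| there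
  -- through its endpoint values.
  have htail : |∫ u in ((M : ℝ) / N)..1, G u| ≤ (|G 0| + |G 1|) * N⁻¹ := by
    have := intervalIntegral.norm_integral_le_of_norm_le_const
      (a := (M : ℝ) / N) (b := 1) (f := G) (C := |G 0| + |G 1|) (by
        intro x hx
        rw [Set.uIoc_of_le hMN1] at hx
        have hx' : x ∈ Set.Icc (0 : ℝ) 1 := ⟨hM0.trans hx.1.le, hx.2⟩
        have a1 := hG (by simp) hx' hx'.1
        have a2 := hG hx' (by simp) hx'.2
        rw [Real.norm_eq_abs, abs_le]
        constructor
        · linarith [neg_abs_le (G 0), abs_nonneg (G 1)]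
        · linarith [le_abs_self (G 1), abs_nonneg (G 0)])
    rw [Real.norm_eq_abs] at this
    refine this.trans (mul_le_mul_of_nonneg_left ?_ (by positivity))
    rw [abs_of_nonneg (by linarith)]
    have h2 : N < M + 1 := Nat.lt_floor_add_one N
    rw [sub_le_iff_le_add, ← one_div, ← add_div, le_div_iff₀ hN]
    linarith
  have hMle : G ((M : ℝ) / N) ≤ G 1 := hG (hmem M le_rfl) (by simp) hMN1
  calc _ = |∑ i ∈ Finset.range M, (N⁻¹ * G ((i + c) / N) -
              ∫ u in ((i : ℝ) / N)..(((i + 1 : ℕ) : ℝ) / N), G u) -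
              ∫ u in ((M : ℝ) / N)..1, G u| := by
        rw [Finset.sum_sub_distrib, hsum, hsplit, Finset.mul_sum]; congr 1; ring
    _ ≤ ∑ i ∈ Finset.range M, (G (((i + 1 : ℕ) : ℝ) / N) - G ((i : ℝ) / N)) * N⁻¹ +
          (|G 0| + |G 1|) * N⁻¹ := by
        refine (abs_sub _ _).trans (add_le_add ?_ htail)
        exact (Finset.abs_sum_le_sum_abs _ _).trans (Finset.sum_le_sum hcell)
    _ = (G (M / N) - G 0 + (|G 0| + |G 1|)) * N⁻¹ := by
        rw [← Finset.sum_mul, Finset.sum_range_sub (fun i : ℕ => G ((i : ℝ) / N))]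
        simp; ring
    _ ≤ _ := by gcongr

/-- Riemann sums of a function of bounded variation converge at the rate of the mesh. -/
lemma exists_riemannSum_le {G : ℝ → ℝ} (hG : BoundedVariationOn G (Set.Icc 0 1)) :
    ∃ C, ∀ N c : ℝ, 0 < N → 0 ≤ c → c ≤ 1 →
      |N⁻¹ * ∑ i ∈ Finset.range ⌊N⌋₊, G ((i + c) / N) - ∫ u in (0 : ℝ)..1, G u| ≤ C * N⁻¹ := by
  -- Jordan decomposition: both sides of the estimate are linear in G.
  obtain ⟨p, q, hp, hq, rfl⟩ :=
    hG.locallyBoundedVariationOn.exists_monotoneOn_sub_monotoneOn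
  refine ⟨(p 1 - p 0 + (|p 0| + |p 1|)) + (q 1 - q 0 + (|q 0| + |q 1|)),
    fun N c hN h0 h1 => ?_⟩
  have hpi : IntervalIntegrable p volume 0 1 :=
    MonotoneOn.intervalIntegrable (by rwa [Set.uIcc_of_le zero_le_one])
  have hqi : IntervalIntegrable q volume 0 1 :=
    MonotoneOn.intervalIntegrable (by rwa [Set.uIcc_of_le zero_le_one])
  have e1 := riemannSum_monotoneOn hp hN h0 h1
  have e2 := riemannSum_monotoneOn hq hN h0 h1
  have := (abs_sub _ _).trans (add_le_add e1 e2)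
  rw [add_mul]
  have e3 : ∫ u in (0 : ℝ)..1, (p - q) u = (∫ u in (0 : ℝ)..1, p u) - ∫ u in (0 : ℝ)..1, q u :=
    intervalIntegral.integral_sub hpi hqi
  have e4 : ∑ i ∈ Finset.range ⌊N⌋₊, (p - q) ((i + c) / N) =
      ∑ i ∈ Finset.range ⌊N⌋₊, p ((i + c) / N) - ∑ i ∈ Finset.range ⌊N⌋₊, q ((i + c) / N) :=
    Finset.sum_sub_distrib _ _
  rw [e3, e4]
  refine (le_of_eq ?_).trans this
  congr 1
  ring

lemma boundedVariationOn_pow (a : ℕ) :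
    BoundedVariationOn (fun u : ℝ => u ^ a) (Set.Icc 0 1) := by
  have h : MonotoneOn (fun u : ℝ => u ^ a) (Set.Icc 0 1) :=
    fun x hx y _ hxy => pow_le_pow_left₀ hx.1 hxy a
  have := h.locallyBoundedVariationOn 0 1 (by simp) (by simp)
  simpa using this

end RiemannSums

/-! ### Kernel moments and the limiting determinant -/

section KernelMoments

lemma intervalIntegrable_of_boundedVariationOn {G : ℝ → ℝ}
    (hG : BoundedVariationOn G (Set.Icc 0 1)) : IntervalIntegrable G volume 0 1 := by
  obtain ⟨p, q, hp, hq, rfl⟩ :=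
    hG.locallyBoundedVariationOn.exists_monotoneOn_sub_monotoneOn
  exact (MonotoneOn.intervalIntegrable (by rwa [Set.uIcc_of_le zero_le_one])).sub
    (MonotoneOn.intervalIntegrable (by rwa [Set.uIcc_of_le zero_le_one]))

lemma boundedVariationOn_kernel_mul_pow {K : ℝ → ℝ}
    (hK : BoundedVariationOn K (Set.Icc 0 1)) (a : ℕ) :
    BoundedVariationOn (fun u => K u * u ^ a) (Set.Icc 0 1) :=
  hK.mul (boundedVariationOn_pow a)

lemma boundedVariationOn_kernelSq_mul_pow {K : ℝ → ℝ}
    (hK : BoundedVariationOn K (Set.Icc 0 1)) (a : ℕ) :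
    BoundedVariationOn (fun u => K u ^ 2 * u ^ a) (Set.Icc 0 1) := by
  have := (hK.mul hK).mul (boundedVariationOn_pow a)
  refine (by convert this using 2 with u; simp [sq])

/-- Strict Cauchy–Schwarz. Up to the factor K₍₀₎ the determinant is ∫ K(u)(u² - r)² du, where r is
the K-weighted mean of u². If this vanished, K would be zero almost everywhere off ±√r, against ∫ K
> 0. -/
lemma kernelMoment_det_pos {K : ℝ → ℝ} (hK0 : ∀ u ∈ Set.Icc (0 : ℝ) 1, 0 ≤ K u)
    (hKpos : 0 < ∫ u in (0 : ℝ)..1, K u) (hK : BoundedVariationOn K (Set.Icc 0 1)) :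
    0 < kernelMoment K 0 * kernelMoment K 4 - kernelMoment K 2 ^ 2 := by
  have hint := fun a => intervalIntegrable_of_boundedVariationOn
    (boundedVariationOn_kernel_mul_pow hK a)
  have h0 : 0 < kernelMoment K 0 := by simpa [kernelMoment] using hKpos
  set r := kernelMoment K 2 / kernelMoment K 0 with hr
  have hquad : ∫ u in (0 : ℝ)..1, K u * (u ^ 2 - r) ^ 2 =
      kernelMoment K 4 - 2 * r * kernelMoment K 2 + r ^ 2 * kernelMoment K 0 := by
    simp only [kernelMoment]
    rw [← intervalIntegral.integral_const_mul, ← intervalIntegral.integral_const_mul,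
      ← intervalIntegral.integral_sub (hint 4) ((hint 2).const_mul _),
      ← intervalIntegral.integral_add ((hint 4).sub ((hint 2).const_mul _))
        ((hint 0).const_mul _)]
    congr 1; ext u; ring
  have hqi : IntervalIntegrable (fun u => K u * (u ^ 2 - r) ^ 2) volume 0 1 := by
    have := ((hint 4).sub ((hint 2).const_mul (2 * r))).add ((hint 0).const_mul (r ^ 2))
    refine this.congr (fun u _ => ?_)
    ring
  have hpos : 0 < ∫ u in (0 : ℝ)..1, K u * (u ^ 2 - r) ^ 2 := by
    refine lt_of_le_of_ne (intervalIntegral.integral_nonneg zero_le_one fun u hu =>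
      mul_nonneg (hK0 u hu) (sq_nonneg _)) fun h => hKpos.ne' ?_
    rw [intervalIntegral.integral_of_le zero_le_one] at h ⊢
    have hae := (setIntegral_eq_zero_iff_of_nonneg_ae
      (ae_restrict_of_forall_mem measurableSet_Ioc fun u hu =>
        mul_nonneg (hK0 u ⟨hu.1.le, hu.2⟩) (sq_nonneg _)) hqi.1).1 h.symm
    have hfin : ({√r, -√r} : Set ℝ).Finite := by simp
    have hne : ∀ᵐ u ∂(volume.restrict (Set.Ioc (0 : ℝ) 1)), u ∉ ({√r, -√r} : Set ℝ) :=
      ae_restrict_of_ae (measure_eq_zero_iff_ae_notMem.1 (hfin.measure_zero volume))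
    refine integral_eq_zero_of_ae ?_
    filter_upwards [hae, hne] with u hu hu'
    rcases mul_eq_zero.1 hu with h | h
    · exact h
    · exfalso
      have h2 : u ^ 2 = r := by
        have := pow_eq_zero_iff (two_ne_zero) |>.1 h
        linarith
      apply hu'
      rw [← h2, Real.sqrt_sq_eq_abs]
      rcases abs_choice u with h | h <;> simp [h]
  rw [hquad] at hpos
  have : kernelMoment K 0 * kernelMoment K 4 - kernelMoment K 2 ^ 2 =
    kernelMoment K 0 * (kernelMoment K 4 - 2 * r * kernelMoment K 2 + r ^ 2 * kernelMoment K 0) := by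
    rw [hr]; field_simp; ring
  rw [this]; positivity

end KernelMoments

/-! ### Taylor expansion of even functions -/

section Taylor

lemma iteratedDeriv_odd_eq_zero_of_even {g : ℝ → ℝ} (hg : ∀ x, g (-x) = g x) {p : ℕ} (hp : Odd p) :
    iteratedDeriv p g 0 = 0 := by
  have h := iteratedDeriv_comp_neg p g 0
  rw [show (fun x => g (-x)) = g from funext hg, hp.neg_one_pow] at h
  simp at h
  linarith

/-- Peano's remainder with the odd derivatives gone. This is why a design with the columns 1 and x²
behaves like a local cubic fit. -/
lemma taylor_four_of_even {g : ℝ → ℝ} (hg : ∀ x, g (-x) = g x) (hC : ContDiff ℝ 4 g) :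
    (fun x => g x - (g 0 + iteratedDeriv 2 g 0 / 2 * x ^ 2 + iteratedDeriv 4 g 0 / 24 * x ^ 4))
      =o[𝓝 0] fun x => x ^ 4 := by
  have h := taylor_isLittleO_univ (x₀ := 0) (n := 4) hC
  refine h.congr (fun x => ?_) (fun x => by simp)
  rw [taylor_within_apply]
  simp only [Finset.sum_range_succ, Finset.sum_range_zero, iteratedDerivWithin_univ]
  rw [iteratedDeriv_odd_eq_zero_of_even hg (p := 1) (by decide),
    iteratedDeriv_odd_eq_zero_of_even hg (p := 3) (by decide)]
  simp [Nat.factorial]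
  ring

lemma isLittleO_sub_of_even {g : ℝ → ℝ} (hg : ∀ x, g (-x) = g x) (hd : DifferentiableAt ℝ g 0) :
    (fun x => g x - g 0) =o[𝓝 0] fun x => x := by
  have h0 : deriv g 0 = 0 := by
    simpa using iteratedDeriv_odd_eq_zero_of_even hg (p := 1) (by decide)
  have := hd.hasDerivAt.isLittleO
  simpa [h0] using this

end Taylor

/-! ### Decay of the autocovariances from smoothness of the spectral density -/

section FourierDecay

/-- Integration by parts for Fourier coefficients of periodic functions, iterated. -/
lemma norm_fourierIntegral_mul_pow {p : ℕ} {g : ℝ → ℂ} (hC : ContDiff ℝ p g)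
    (hper : Function.Periodic g (2 * Real.pi)) (h : ℤ) :
    ‖∫ w in (0 : ℝ)..(2 * Real.pi), g w * Complex.exp (Complex.I * w * h)‖ * |(h : ℝ)| ^ p =
      ‖∫ w in (0 : ℝ)..(2 * Real.pi), iteratedDeriv p g w * Complex.exp (Complex.I * w * h)‖
        ∨ h = 0 := by
  by_cases hh : h = 0
  · exact Or.inr hh
  left
  induction p generalizing g with
  | zero => simp
  | succ p ih =>
    have hC1 : ContDiff ℝ p (deriv g) := by
      have := (contDiff_succ_iff_deriv (n := p)).1 (by exact_mod_cast hC)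
      exact this.2.2
    have hd : Differentiable ℝ g := hC.differentiable (by simp)
    have hper' : Function.Periodic (deriv g) (2 * Real.pi) := fun x => by
      rw [← deriv_comp_add_const]; congr 1; ext y; exact hper y
    have hhC : (h : ℂ) ≠ 0 := by exact_mod_cast hh
    have hIh : Complex.I * (h : ℂ) ≠ 0 := mul_ne_zero Complex.I_ne_zero hhC
    have hv : ∀ w : ℝ, HasDerivAt (fun w : ℝ => Complex.exp (Complex.I * w * h) / (Complex.I * h))
        (Complex.exp (Complex.I * w * h)) w := by
      intro w
      have h1 : HasDerivAt (fun w : ℝ => Complex.I * (w : ℂ) * h) (Complex.I * h) w := by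
        have := ((Complex.ofRealCLM.hasDerivAt (x := w)).const_mul Complex.I).mul_const (h : ℂ)
        simpa using this
      have := (h1.cexp).div_const (Complex.I * (h : ℂ))
      rwa [mul_div_assoc, div_self hIh, mul_one] at this
    have hcexp : Continuous fun w : ℝ => Complex.exp (Complex.I * w * h) := by fun_prop
    -- The boundary terms will cancel, because g and the exponential take equal values at 0 and 2π.
    have hparts := intervalIntegral.integral_mul_deriv_eq_deriv_mul (a := 0) (b := 2 * Real.pi)
      (u := g) (u' := deriv g) (fun x _ => (hd x).hasDerivAt) (fun x _ => hv x)
      (hC1.continuous.intervalIntegrable _ _) (hcexp.intervalIntegrable _ _)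
    have hexp : Complex.exp (Complex.I * ((2 * Real.pi : ℝ) : ℂ) * h) = 1 := by
      rw [Complex.exp_eq_one_iff]; exact ⟨h, by push_cast; ring⟩
    have hg0 : g (2 * Real.pi) = g 0 := by simpa using hper 0
    have hfac : ∫ w in (0 : ℝ)..(2 * Real.pi), deriv g w *
        (Complex.exp (Complex.I * w * h) / (Complex.I * h)) =
        (∫ w in (0 : ℝ)..(2 * Real.pi), deriv g w * Complex.exp (Complex.I * w * h)) /
          (Complex.I * h) := by
      rw [← intervalIntegral.integral_div]; congr 1; ext w; ring
    rw [hexp, hg0, hfac] at hparts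
    have hn : ‖∫ w in (0 : ℝ)..(2 * Real.pi), g w * Complex.exp (Complex.I * w * h)‖ * |(h : ℝ)| =
        ‖∫ w in (0 : ℝ)..(2 * Real.pi), deriv g w * Complex.exp (Complex.I * w * h)‖ := by
      rw [hparts]
      simp only [Complex.ofReal_zero, mul_zero, zero_mul, Complex.exp_zero, sub_self, zero_sub,
        norm_neg, norm_div, norm_mul, Complex.norm_I, one_mul, Complex.norm_intCast]
      have : |(h : ℝ)| ≠ 0 := by simpa using hh
      exact div_mul_cancel₀ _ this
    rw [iteratedDeriv_succ', ← ih hC1 hper', ← hn]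
    ring

lemma exists_fourierIntegral_le {p : ℕ} {g : ℝ → ℂ} (hC : ContDiff ℝ p g)
    (hper : Function.Periodic g (2 * Real.pi)) :
    ∃ C, ∀ h : ℤ, h ≠ 0 →
      ‖∫ w in (0 : ℝ)..(2 * Real.pi), g w * Complex.exp (Complex.I * w * h)‖ * |(h : ℝ)| ^ p
        ≤ C := by
  obtain ⟨B, hB⟩ := isCompact_Icc.exists_bound_of_continuousOn (s := Set.Icc 0 (2 * Real.pi))
    (hC.continuous_iteratedDeriv p le_rfl).continuousOn
  refine ⟨B * |2 * Real.pi - 0|, fun h hh => ?_⟩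
  rw [(norm_fourierIntegral_mul_pow hC hper h).resolve_right hh]
  refine intervalIntegral.norm_integral_le_of_norm_le_const fun w hw => ?_
  rw [Set.uIoc_of_le (by positivity)] at hw
  rw [norm_mul, show Complex.I * (w : ℂ) * (h : ℂ) = ((w * h : ℝ) : ℂ) * Complex.I by
    push_cast; ring, Complex.norm_exp_ofReal_mul_I, mul_one]
  exact hB w ⟨hw.1.le, hw.2⟩

lemma integral_exp_int_mul (k : ℤ) :
    ∫ w in (0 : ℝ)..(2 * Real.pi), Complex.exp (Complex.I * w * k) =
      if k = 0 then 2 * (Real.pi : ℂ) else 0 := by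
  split_ifs with hk
  · subst hk; simp
  · have hkC : (k : ℂ) ≠ 0 := by exact_mod_cast hk
    have := integral_exp_mul_complex (a := 0) (b := 2 * Real.pi)
      (c := Complex.I * k) (mul_ne_zero Complex.I_ne_zero hkC)
    rw [show (fun w : ℝ => Complex.exp (Complex.I * w * k)) =
      fun w : ℝ => Complex.exp (Complex.I * k * w) by ext w; ring_nf, this]
    have hexp : Complex.exp (Complex.I * k * ((2 * Real.pi : ℝ) : ℂ)) = 1 := by
      rw [Complex.exp_eq_one_iff]; exact ⟨k, by push_cast; ring⟩
    rw [hexp]; simp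

lemma norm_exp_I_mul_mul (w h : ℝ) : ‖Complex.exp (-Complex.I * w * h)‖ = 1 := by
  rw [show -Complex.I * (w : ℂ) * (h : ℂ) = ((-(w * h) : ℝ) : ℂ) * Complex.I by
    push_cast; ring, Complex.norm_exp_ofReal_mul_I]

/-- Integrate the series term by term, dominated by |γ(h)|; orthogonality of the exponentials leaves
the single lag h₀. -/
lemma fourier_inversion {γ : ℤ → ℝ} (hγ : Summable γ) (h₀ : ℤ) :
    ∫ w in (0 : ℝ)..(2 * Real.pi), ((2 * (Real.pi : ℂ))⁻¹ *
      ∑' h : ℤ, Complex.exp (-Complex.I * w * h) * (γ h : ℂ)) *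
        Complex.exp (Complex.I * w * h₀) = γ h₀ := by
  have hcont : ∀ h : ℤ, Continuous fun w : ℝ => Complex.exp (-Complex.I * w * h) * (γ h : ℂ) *
      Complex.exp (Complex.I * w * h₀) := fun h => by fun_prop
  have hnorm : ∀ (h : ℤ) (w : ℝ), ‖Complex.exp (-Complex.I * w * h) * (γ h : ℂ) *
      Complex.exp (Complex.I * w * h₀)‖ = |γ h| := by
    intro h w
    have e1 := norm_exp_I_mul_mul w h
    have e2 := norm_exp_I_mul_mul w (-h₀)
    push_cast at e1 e2
    rw [norm_mul, norm_mul, e1, show Complex.I * (w : ℂ) * (h₀ : ℂ) =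
      -Complex.I * w * (-h₀) by ring, e2]
    simp
  have hs := intervalIntegral.hasSum_integral_of_dominated_convergence (μ := volume) (a := 0)
    (b := 2 * Real.pi) (F := fun (h : ℤ) (w : ℝ) => Complex.exp (-Complex.I * w * h) * (γ h : ℂ) *
      Complex.exp (Complex.I * w * h₀)) (f := fun w : ℝ => ∑' h : ℤ,
        Complex.exp (-Complex.I * w * h) * (γ h : ℂ) * Complex.exp (Complex.I * w * h₀))
    (fun h _ => |γ h|) (fun h => (hcont h).aestronglyMeasurable)
    (fun h => Eventually.of_forall fun w _ => (hnorm h w).le)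
    (Eventually.of_forall fun w _ => hγ.abs)
    intervalIntegrable_const
    (Eventually.of_forall fun w _ => (Summable.of_norm (by simpa only [hnorm] using hγ.abs)).hasSum)
  have hterm : ∀ h : ℤ, ∫ w in (0 : ℝ)..(2 * Real.pi),
      Complex.exp (-Complex.I * w * h) * (γ h : ℂ) * Complex.exp (Complex.I * w * h₀) =
      if h = h₀ then 2 * (Real.pi : ℂ) * γ h₀ else 0 := by
    intro h
    have := integral_exp_int_mul (h₀ - h)
    calc _ = ∫ w in (0 : ℝ)..(2 * Real.pi), (γ h : ℂ) *
          Complex.exp (Complex.I * w * ((h₀ - h : ℤ) : ℂ)) := by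
          congr 1; ext w
          rw [mul_comm (Complex.exp _) (γ h : ℂ), mul_assoc, ← Complex.exp_add]
          congr 2; push_cast; ring
      _ = _ := by
          rw [intervalIntegral.integral_const_mul, this]
          by_cases hh : h = h₀
          · subst hh; simp; ring
          · rw [if_neg hh, if_neg (by omega)]; simp
  simp only [hterm] at hs
  have hsum := hs.unique (hasSum_ite_eq h₀ (2 * (Real.pi : ℂ) * γ h₀))
  have hpi : (2 * (Real.pi : ℂ)) ≠ 0 := by simp [Real.pi_ne_zero]
  calc _ = (2 * (Real.pi : ℂ))⁻¹ * ∫ w in (0 : ℝ)..(2 * Real.pi), ∑' h : ℤ,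
        Complex.exp (-Complex.I * w * h) * (γ h : ℂ) * Complex.exp (Complex.I * w * h₀) := by
        rw [← intervalIntegral.integral_const_mul]
        congr 1; ext w; rw [tsum_mul_right]; ring
    _ = _ := by rw [hsum]; field_simp

/-- Three integrations by parts give |γ(h)| ≤ C|h|⁻³, so |h||γ(h)| is dominated by C/h². -/
lemma summable_abs_mul_of_contDiff {γ : ℤ → ℝ} (hγ : Summable γ)
    (hC : ContDiff ℝ 3 fun w : ℝ => (2 * (Real.pi : ℂ))⁻¹ *
      ∑' h : ℤ, Complex.exp (-Complex.I * w * h) * (γ h : ℂ)) :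
    Summable fun h : ℤ => |(h : ℝ)| * |γ h| := by
  obtain ⟨C, hC⟩ := exists_fourierIntegral_le (p := 3) hC (fun w => by
    congr 2; ext h; congr 1
    rw [Complex.exp_eq_exp_iff_exists_int]
    exact ⟨-h, by push_cast; ring⟩)
  refine Summable.of_nonneg_of_le (fun h => by positivity) (fun h => ?_)
    ((Real.summable_one_div_int_pow (p := 2)).2 one_lt_two |>.mul_left C)
  by_cases hh : h = 0
  · simp [hh]
  have hh' := hC h hh
  rw [fourier_inversion hγ, Complex.norm_real, Real.norm_eq_abs] at hh'
  have hpos : 0 < |(h : ℝ)| := by simpa using hh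
  rw [← sq_abs, mul_one_div, le_div_iff₀ (by positivity)]
  calc _ = |γ h| * |(h : ℝ)| ^ 3 := by ring
    _ ≤ C := hh'

end FourierDecay

/-! ### Splitting remainders and propagating rates -/

section Remainders

/-- Converts a bound with arbitrary ε into the two separate remainders that the theorem asks for,
with an identity valid for every n. -/
lemma exists_isBigO_add_isLittleO {R a φ ψ : ℕ → ℝ}
    (h : ∀ ε > 0, ∀ᶠ n in atTop, |R n| ≤ |a n| + ε * |ψ n|) (ha : a =O[atTop] φ) :
    ∃ r₁ r₂ : ℕ → ℝ, r₁ =O[atTop] φ ∧ r₂ =o[atTop] ψ ∧ ∀ n, R n = r₁ n + r₂ n := by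
  -- The first remainder is R truncated to [-|a|, |a|]; the overshoot is then at most ε|ψ|
  -- eventually, for each ε.
  refine ⟨fun n => max (-|a n|) (min (R n) |a n|), fun n => R n - max (-|a n|) (min (R n) |a n|),
    (IsBigO.of_bound 1 (Eventually.of_forall fun n => ?_)).trans ha,
    IsLittleO.of_bound fun ε hε => ?_, fun n => by ring⟩
  · simp only [Real.norm_eq_abs, one_mul]
    have h1 := abs_nonneg (a n)
    rw [abs_le]
    exact ⟨le_max_left _ _, max_le (by linarith) (min_le_right _ _)⟩
  · filter_upwards [h ε hε] with n hn
    simp only [Real.norm_eq_abs]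
    have h0 := abs_nonneg (a n)
    have h1 : 0 ≤ ε * |ψ n| := by positivity
    rw [abs_le] at hn
    rw [abs_le]
    rcases max_cases (-|a n|) (min (R n) |a n|) with h2 | h2 <;>
      rcases min_cases (R n) |a n| with h3 | h3 <;> constructor <;> linarith

/-- Since e tends to 0, the product of two errors is again O(e). Together with `isBigO_inv_sub` this
carries the rate 1/N from the grid moments to rational expressions in them. -/
lemma isBigO_mul_sub {l : Filter ℕ} {x y e : ℕ → ℝ} {a b : ℝ} (he : Tendsto e l (𝓝 0))
    (hx : (fun n => x n - a) =O[l] e) (hy : (fun n => y n - b) =O[l] e) :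
    (fun n => x n * y n - a * b) =O[l] e := by
  have h1 : (fun n => (x n - a) * (y n - b)) =O[l] e := by
    have := hx.mul (hy.trans (he.isBigO_one ℝ))
    simpa using this
  have := (h1.add (hy.const_mul_left a)).add (hx.const_mul_left b)
  refine this.congr_left fun n => ?_
  ring

lemma isBigO_inv_sub {l : Filter ℕ} {x e : ℕ → ℝ} {a : ℝ} (ha : a ≠ 0) (he : Tendsto e l (𝓝 0))
    (hx : (fun n => x n - a) =O[l] e) : (fun n => (x n)⁻¹ - a⁻¹) =O[l] e := by
  have hxa : Tendsto x l (𝓝 a) := by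
    have := (hx.trans_tendsto he).add_const a
    simpa using this
  have h1 : (fun n => (x n - a) * (-(x n)⁻¹ * a⁻¹)) =O[l] e := by
    have hb : (fun n => -(x n)⁻¹ * a⁻¹) =O[l] (fun _ => (1 : ℝ)) :=
      ((hxa.inv₀ ha).neg.mul_const a⁻¹).isBigO_one ℝ
    simpa using hx.mul hb
  refine h1.congr' ?_ EventuallyEq.rfl
  filter_upwards [hxa.eventually_ne ha] with n hn
  field_simp
  ring

end Remainders

/-! ### Fourth moments of Gaussian linear forms -/

section Isserlis

lemma integral_pow_four_gaussianReal (v : NNReal) :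
    ∫ x, x ^ 4 ∂(gaussianReal 0 v) = 3 * (v : ℝ) ^ 2 := by
  have h := iteratedDeriv_mgf_zero (X := fun x : ℝ => x) (μ := gaussianReal 0 v) (by simp) 4
  simp only [Pi.pow_apply] at h
  rw [← h, mgf_fun_id_gaussianReal]
  have hexp : ∀ t : ℝ, HasDerivAt (fun t : ℝ => Real.exp (0 * t + v * t ^ 2 / 2))
      (v * t * Real.exp (0 * t + v * t ^ 2 / 2)) t := by
    intro t
    have h1 : HasDerivAt (fun t : ℝ => 0 * t + v * t ^ 2 / 2) (v * t) t := by
      have := ((hasDerivAt_id t).const_mul 0).add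
        ((((hasDerivAt_id t).pow 2).const_mul (v : ℝ)).div_const 2)
      convert! this using 1
      simp; ring
    have := h1.exp
    rwa [mul_comm] at this
  -- Differentiating q(t)exp(vt²/2) replaces the polynomial q by q' + q·vt, so four derivatives of
  -- the moment generating function reduce to polynomial algebra.
  have hstep : ∀ (q q' : ℝ → ℝ), (∀ t, HasDerivAt q (q' t) t) →
      deriv (fun t => q t * Real.exp (0 * t + v * t ^ 2 / 2)) =
        fun t => (q' t + q t * (v * t)) * Real.exp (0 * t + v * t ^ 2 / 2) := by
    intro q q' hq
    ext t
    rw [((hq t).fun_mul (hexp t)).deriv]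
    ring
  have hid : ∀ t : ℝ, HasDerivAt (fun t : ℝ => t) 1 t := fun t => hasDerivAt_id t
  have d1 : deriv (fun t : ℝ => Real.exp (0 * t + v * t ^ 2 / 2)) =
      fun t => (v * t) * Real.exp (0 * t + v * t ^ 2 / 2) := by
    ext t; exact (hexp t).deriv
  have p1 : ∀ t : ℝ, HasDerivAt (fun t : ℝ => (v : ℝ) * t) v t := fun t => by
    simpa using (hid t).const_mul (v : ℝ)
  have p2 : ∀ t : ℝ, HasDerivAt (fun t : ℝ => (v : ℝ) + v * t * (v * t)) (2 * v ^ 2 * t) t :=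
    fun t => by
      convert! ((p1 t).mul (p1 t)).const_add (v : ℝ) using 1
      ring
  have p3 : ∀ t : ℝ, HasDerivAt
      (fun t : ℝ => 2 * (v : ℝ) ^ 2 * t + (v + v * t * (v * t)) * (v * t))
      (2 * v ^ 2 + (2 * v ^ 2 * t * (v * t) + (v + v * t * (v * t)) * v)) t := fun t => by
    convert! ((hid t).const_mul (2 * (v : ℝ) ^ 2)).add ((p2 t).mul (p1 t)) using 1
    ring
  rw [iteratedDeriv_succ, iteratedDeriv_succ, iteratedDeriv_succ, iteratedDeriv_one, d1,
    hstep _ _ p1, hstep _ _ p2, hstep _ _ p3]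
  simp
  ring

variable {E : Type*} [NormedAddCommGroup E] [NormedSpace ℝ E] [MeasurableSpace E] [BorelSpace E]

/-- The centered version of a linear form. -/
noncomputable def centeredForm (μ : Measure E) (L : StrongDual ℝ E) (x : E) : ℝ := L x - ∫ y, L y ∂μ

lemma memLp_centeredForm (μ : Measure E) [IsGaussian μ] (L : StrongDual ℝ E) {p : ENNReal}
    (hp : p ≠ ⊤) : MemLp (centeredForm μ L) p μ :=
  (IsGaussian.memLp_dual μ L p hp).sub (memLp_const _)

lemma centeredForm_add (μ : Measure E) [IsGaussian μ] (L L' : StrongDual ℝ E) (x : E) :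
    centeredForm μ (L + L') x = centeredForm μ L x + centeredForm μ L' x := by
  simp only [centeredForm, _root_.add_apply]
  rw [integral_add (IsGaussian.integrable_dual μ L) (IsGaussian.integrable_dual μ L')]
  ring

lemma centeredForm_sub (μ : Measure E) [IsGaussian μ] (L L' : StrongDual ℝ E) (x : E) :
    centeredForm μ (L - L') x = centeredForm μ L x - centeredForm μ L' x := by
  simp only [centeredForm, _root_.sub_apply]
  rw [integral_sub (IsGaussian.integrable_dual μ L) (IsGaussian.integrable_dual μ L')]
  ring

lemma memLp_centeredForm_mul (μ : Measure E) [IsGaussian μ] (L₁ L₂ : StrongDual ℝ E) :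
    MemLp (fun x => centeredForm μ L₁ x * centeredForm μ L₂ x) 2 μ :=
  haveI : ENNReal.HolderTriple 4 4 2 := ⟨by
    rw [show (4 : ENNReal) = 2 * 2 by norm_num, ENNReal.mul_inv (by simp) (by simp), ← mul_add,
      ENNReal.inv_two_add_inv_two, mul_one]⟩
  (memLp_centeredForm μ L₂ (p := 4) (by simp)).mul' (memLp_centeredForm μ L₁ (p := 4) (by simp))

variable [CompleteSpace E] [SecondCountableTopology E]

lemma integral_centeredForm_pow_four (μ : Measure E) [IsGaussian μ] (L : StrongDual ℝ E) :
    ∫ x, centeredForm μ L x ^ 4 ∂μ = 3 * covarianceBilinDual μ L L ^ 2 := by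
  have hmap := IsGaussian.map_eq_gaussianReal (μ := μ) L
  have h1 : ∫ x, centeredForm μ L x ^ 4 ∂μ = ∫ y, (y - ∫ x, L x ∂μ) ^ 4 ∂(μ.map L) := by
    rw [integral_map (by fun_prop) (by fun_prop)]; rfl
  rw [h1, hmap, covarianceBilinDual_self_eq_variance (IsGaussian.memLp_two_id)]
  have h2 := integral_map (μ := gaussianReal (∫ x, L x ∂μ) Var[L; μ].toNNReal)
    (φ := fun y => y - ∫ x, L x ∂μ) (f := fun y : ℝ => y ^ 4) (by fun_prop) (by fun_prop)
  rw [← h2, gaussianReal_map_sub_const, sub_self, integral_pow_four_gaussianReal,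
    Real.coe_toNNReal _ (variance_nonneg _ _)]

/-- Isserlis' formula for the fourth mixed moment. -/
lemma integral_centeredForm_mul_four (μ : Measure E) [IsGaussian μ]
    (L₁ L₂ L₃ L₄ : StrongDual ℝ E) :
    ∫ x, centeredForm μ L₁ x * centeredForm μ L₂ x *
        (centeredForm μ L₃ x * centeredForm μ L₄ x) ∂μ =
      covarianceBilinDual μ L₁ L₂ * covarianceBilinDual μ L₃ L₄ +
      covarianceBilinDual μ L₁ L₃ * covarianceBilinDual μ L₂ L₄ +
      covarianceBilinDual μ L₁ L₄ * covarianceBilinDual μ L₂ L₃ := by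
  have hi : ∀ L : StrongDual ℝ E, Integrable (fun x => centeredForm μ L x ^ 4) μ := fun L => by
    have := (memLp_centeredForm μ L (p := 4) (by simp)).integrable_norm_pow (p := 4) (by simp)
    refine this.congr (Eventually.of_forall fun x => ?_)
    simp only [Real.norm_eq_abs]
    exact Even.pow_abs (by decide) _
  -- Polarization: the signed sum over the signs of L₂, L₃, L₄ keeps only the monomial containing
  -- all four forms, with coefficient 8·4! = 192. Fourth moments of single forms therefore suffice.
  have hpol : ∀ x, centeredForm μ L₁ x * centeredForm μ L₂ x *
        (centeredForm μ L₃ x * centeredForm μ L₄ x) = 192⁻¹ *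
      (centeredForm μ (L₁ + L₂ + L₃ + L₄) x ^ 4 - centeredForm μ (L₁ + L₂ + L₃ - L₄) x ^ 4
      - centeredForm μ (L₁ + L₂ - L₃ + L₄) x ^ 4 + centeredForm μ (L₁ + L₂ - L₃ - L₄) x ^ 4
      - centeredForm μ (L₁ - L₂ + L₃ + L₄) x ^ 4 + centeredForm μ (L₁ - L₂ + L₃ - L₄) x ^ 4
      + centeredForm μ (L₁ - L₂ - L₃ + L₄) x ^ 4
      - centeredForm μ (L₁ - L₂ - L₃ - L₄) x ^ 4) := by
    intro x
    simp only [centeredForm_add, centeredForm_sub]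
    ring
  simp only [hpol]
  rw [integral_const_mul]
  have h1 := hi (L₁ + L₂ + L₃ + L₄)
  have h2 := hi (L₁ + L₂ + L₃ - L₄)
  have h3 := hi (L₁ + L₂ - L₃ + L₄)
  have h4 := hi (L₁ + L₂ - L₃ - L₄)
  have h5 := hi (L₁ - L₂ + L₃ + L₄)
  have h6 := hi (L₁ - L₂ + L₃ - L₄)
  have h7 := hi (L₁ - L₂ - L₃ + L₄)
  have h8 := hi (L₁ - L₂ - L₃ - L₄)
  rw [integral_sub (by fun_prop) h8, integral_add (by fun_prop) h7, integral_add (by fun_prop) h6,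
    integral_sub (by fun_prop) h5, integral_add (by fun_prop) h4, integral_sub (by fun_prop) h3,
    integral_sub h1 h2]
  simp only [integral_centeredForm_pow_four, map_add, map_sub, _root_.add_apply, _root_.sub_apply]
  rw [covarianceBilinDual_comm L₂ L₁, covarianceBilinDual_comm L₃ L₁,
    covarianceBilinDual_comm L₄ L₁, covarianceBilinDual_comm L₃ L₂,
    covarianceBilinDual_comm L₄ L₂, covarianceBilinDual_comm L₄ L₃]
  ring

lemma integral_centeredForm_mul (μ : Measure E) [IsGaussian μ] (L₁ L₂ : StrongDual ℝ E) :
    ∫ x, centeredForm μ L₁ x * centeredForm μ L₂ x ∂μ = covarianceBilinDual μ L₁ L₂ :=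
  (covarianceBilinDual_apply IsGaussian.memLp_two_id _ _).symm

/-- Subtracting the product of the two means removes the first of the three Isserlis pairings. -/
lemma covariance_centeredForm_mul (μ : Measure E) [IsGaussian μ]
    (L₁ L₂ L₃ L₄ : StrongDual ℝ E) :
    cov[fun x => centeredForm μ L₁ x * centeredForm μ L₂ x,
        fun x => centeredForm μ L₃ x * centeredForm μ L₄ x; μ] =
      covarianceBilinDual μ L₁ L₃ * covarianceBilinDual μ L₂ L₄ +
      covarianceBilinDual μ L₁ L₄ * covarianceBilinDual μ L₂ L₃ := by
  rw [covariance_eq_sub (memLp_centeredForm_mul μ L₁ L₂) (memLp_centeredForm_mul μ L₃ L₄)]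
  simp only [Pi.mul_apply]
  rw [integral_centeredForm_mul_four, integral_centeredForm_mul, integral_centeredForm_mul]
  ring
end Isserlis

/-! ### Linear combinations of the observations and their second moments -/

section LinearCombinations

variable {Ω : Type*} [MeasurableSpace Ω] {m : ℕ} {X : ℤ → Ω → Fin m → ℝ} {P : Measure Ω}

/-- Linear combination of the centered `j`-th components of `X_1, …, X_n`. -/
noncomputable def linComb (X : ℤ → Ω → Fin m → ℝ) (P : Measure Ω) (n : ℕ) (a : ℤ → ℝ) (j : Fin m)
    (ω : Ω) : ℝ :=
  ∑ t ∈ Finset.Icc (1 : ℤ) n, a t * (X t ω j - ∫ ω', X t ω' j ∂P)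

/-- The linear form on the sample space `(ℝ^m)^n` that underlies `linComb`. -/
noncomputable def sampleForm (n : ℕ) (a : ℤ → ℝ) (j : Fin m) :
    StrongDual ℝ (Finset.Icc (1 : ℤ) n → Fin m → ℝ) :=
  ∑ t : Finset.Icc (1 : ℤ) n,
    a t • ((ContinuousLinearMap.proj (R := ℝ) (φ := fun _ : Fin m => ℝ) j).comp
      (ContinuousLinearMap.proj (R := ℝ) (φ := fun _ : Finset.Icc (1 : ℤ) n => Fin m → ℝ) t))

lemma sampleForm_apply (n : ℕ) (a : ℤ → ℝ) (j : Fin m) (x : Finset.Icc (1 : ℤ) n → Fin m → ℝ) :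
    sampleForm n a j x = ∑ t : Finset.Icc (1 : ℤ) n, a t * x t j := by
  simp [sampleForm]

lemma integrable_component (hgauss : IsGaussianProcess X P) (t : ℤ) (j : Fin m) :
    Integrable (fun ω => X t ω j) P :=
  ((hgauss.hasGaussianLaw_eval t).map_fun
    (ContinuousLinearMap.proj (R := ℝ) (φ := fun _ : Fin m => ℝ) j)).integrable

lemma memLp_component (hgauss : IsGaussianProcess X P) (t : ℤ) (j : Fin m) :
    MemLp (fun ω => X t ω j) 2 P :=
  ((hgauss.hasGaussianLaw_eval t).map_fun
    (ContinuousLinearMap.proj (R := ℝ) (φ := fun _ : Fin m => ℝ) j)).memLp_two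

/-- The bridge to the previous section: the law of the sample X_1, …, X_n is a Gaussian measure on a
finite-dimensional space, on which the combination is a centered linear form. -/
lemma linComb_eq_centeredForm (hgauss : IsGaussianProcess X P) (n : ℕ) (a : ℤ → ℝ) (j : Fin m)
    (ω : Ω) :
    linComb X P n a j ω =
      centeredForm (P.map fun ω => (Finset.Icc (1 : ℤ) n).restrict (X · ω)) (sampleForm n a j)
        ((Finset.Icc (1 : ℤ) n).restrict (X · ω)) := by
  have hZ := (hgauss.hasGaussianLaw (Finset.Icc (1 : ℤ) n)).aemeasurable
  rw [centeredForm, integral_map hZ (by fun_prop)]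
  simp only [sampleForm_apply, Finset.restrict]
  rw [integral_finsetSum _ fun (t : Finset.Icc (1 : ℤ) n) _ =>
    (integrable_component hgauss t j).const_mul (a t)]
  simp only [integral_const_mul]
  rw [← Finset.sum_sub_distrib, linComb, ← Finset.sum_coe_sort]
  exact Finset.sum_congr rfl fun t _ => by ring

lemma memLp_linComb_mul (hgauss : IsGaussianProcess X P) (n : ℕ) (a b : ℤ → ℝ) (j k : Fin m) :
    MemLp (fun ω => linComb X P n a j ω * linComb X P n b k ω) 2 P := by
  have hZ := hgauss.hasGaussianLaw (Finset.Icc (1 : ℤ) n)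
  have := hZ.isGaussian_map
  simp only [linComb_eq_centeredForm hgauss]
  exact (memLp_centeredForm_mul _ (sampleForm n a j) (sampleForm n b k)).comp_of_map hZ.aemeasurable

lemma integral_linComb_mul_eq_covarianceBilinDual (hgauss : IsGaussianProcess X P) (n : ℕ)
    (a b : ℤ → ℝ) (j k : Fin m) :
    ∫ ω, linComb X P n a j ω * linComb X P n b k ω ∂P =
      covarianceBilinDual (P.map fun ω => (Finset.Icc (1 : ℤ) n).restrict (X · ω))
        (sampleForm n a j) (sampleForm n b k) := by
  have hZ := hgauss.hasGaussianLaw (Finset.Icc (1 : ℤ) n)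
  have := hZ.isGaussian_map
  rw [← integral_centeredForm_mul, integral_map hZ.aemeasurable
    (memLp_centeredForm_mul _ _ _).aestronglyMeasurable]
  simp only [linComb_eq_centeredForm hgauss]

lemma covariance_linComb_mul (hgauss : IsGaussianProcess X P) (n : ℕ) (a b c d : ℤ → ℝ)
    (i j k l : Fin m) :
    cov[fun ω => linComb X P n a i ω * linComb X P n b j ω,
        fun ω => linComb X P n c k ω * linComb X P n d l ω; P] =
      (∫ ω, linComb X P n a i ω * linComb X P n c k ω ∂P) *
        (∫ ω, linComb X P n b j ω * linComb X P n d l ω ∂P) +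
      (∫ ω, linComb X P n a i ω * linComb X P n d l ω ∂P) *
        (∫ ω, linComb X P n b j ω * linComb X P n c k ω ∂P) := by
  have hZ := hgauss.hasGaussianLaw (Finset.Icc (1 : ℤ) n)
  have := hZ.isGaussian_map
  simp only [integral_linComb_mul_eq_covarianceBilinDual hgauss]
  rw [← covariance_centeredForm_mul, covariance_map_fun
    (memLp_centeredForm_mul _ _ _).aestronglyMeasurable
    (memLp_centeredForm_mul _ _ _).aestronglyMeasurable hZ.aemeasurable]
  simp only [linComb_eq_centeredForm hgauss]

/-- Means and covariance depend only on the joint law at the two times, and (t, u) is the pair (t -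
u, 0) shifted by u. -/
lemma covariance_eq_autocov (hstat : IsStrictlyStationary X P) (t u : ℤ) (j k : Fin m) :
    cov[fun ω => X t ω j, fun ω => X u ω k; P] = autocov X P j k (t - u) := by
  have hS := hstat u {t - u, 0}
  have h0 : (t - u) ∈ ({t - u, 0} : Finset ℤ) := by simp
  have h1 : (0 : ℤ) ∈ ({t - u, 0} : Finset ℤ) := by simp
  have hX : ∫ ω, X t ω j ∂P = ∫ ω, X (t - u) ω j ∂P := by
    have := (hS.comp (u := fun x : ({t - u, 0} : Finset ℤ) → Fin m → ℝ => x ⟨_, h0⟩ j)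
      (by fun_prop)).integral_eq
    simpa [Function.comp_def] using this
  have hY : ∫ ω, X u ω k ∂P = ∫ ω, X 0 ω k ∂P := by
    have := (hS.comp (u := fun x : ({t - u, 0} : Finset ℤ) → Fin m → ℝ => x ⟨_, h1⟩ k)
      (by fun_prop)).integral_eq
    simpa [Function.comp_def] using this
  rw [autocov, covariance, covariance, hX, hY]
  have := (hS.comp (u := fun x : ({t - u, 0} : Finset ℤ) → Fin m → ℝ =>
    (x ⟨_, h0⟩ j - ∫ ω, X (t - u) ω j ∂P) * (x ⟨_, h1⟩ k - ∫ ω, X 0 ω k ∂P))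
      (by fun_prop)).integral_eq
  simpa [Function.comp_def] using this

lemma integral_component_eq (hstat : IsStrictlyStationary X P) (t : ℤ) (j : Fin m) :
    ∫ ω, X t ω j ∂P = ∫ ω, X 0 ω j ∂P := by
  have := ((hstat t {0}).comp (u := fun x : ({0} : Finset ℤ) → Fin m → ℝ => x ⟨0, by simp⟩ j)
      (by fun_prop)).integral_eq
  simpa [Function.comp_def] using this

lemma autocov_neg (hstat : IsStrictlyStationary X P) (j k : Fin m) (h : ℤ) :
    autocov X P j k (-h) = autocov X P k j h := by
  rw [← zero_sub, ← covariance_eq_autocov hstat, covariance_comm, covariance_eq_autocov hstat,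
    sub_zero]

lemma integral_linComb_mul (hstat : IsStrictlyStationary X P) (hgauss : IsGaussianProcess X P)
    (n : ℕ) (a b : ℤ → ℝ) (j k : Fin m) :
    ∫ ω, linComb X P n a j ω * linComb X P n b k ω ∂P =
      ∑ t ∈ Finset.Icc (1 : ℤ) n, ∑ u ∈ Finset.Icc (1 : ℤ) n,
        a t * b u * autocov X P j k (t - u) := by
  have := hgauss.isProbabilityMeasure
  have hc : ∀ t j, MemLp (fun ω => X t ω j - ∫ ω', X t ω' j ∂P) 2 P := fun t j =>
    (memLp_component hgauss t j).sub (memLp_const _)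
  have hi : ∀ t u, Integrable (fun ω => a t * (X t ω j - ∫ ω', X t ω' j ∂P) *
      (b u * (X u ω k - ∫ ω', X u ω' k ∂P))) P := fun t u =>
    ((hc t j).const_mul (a t)).integrable_mul ((hc u k).const_mul (b u))
  simp only [linComb, Finset.sum_mul_sum]
  rw [integral_finsetSum _ fun t _ => integrable_finsetSum _ fun u _ => hi t u]
  refine Finset.sum_congr rfl fun t _ => ?_
  rw [integral_finsetSum _ fun u _ => hi t u]
  refine Finset.sum_congr rfl fun u _ => ?_
  rw [← covariance_eq_autocov hstat, covariance, ← integral_const_mul]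
  congr 1; ext ω; ring

end LinearCombinations

/-! ### The periodogram at Fourier frequencies -/

section Periodogram

lemma sum_exp_fourier {n : ℕ} (hn : 0 < n) (q : ℤ) :
    ∑ u ∈ Finset.Icc (1 : ℤ) n, Complex.exp (-Complex.I * ((2 * Real.pi * q / n : ℝ) : ℂ) * u) =
      if (n : ℤ) ∣ q then (n : ℂ) else 0 := by
  have hnC : (n : ℂ) ≠ 0 := by exact_mod_cast hn.ne'
  set z : ℂ := Complex.exp (-Complex.I * ((2 * Real.pi * q / n : ℝ) : ℂ)) with hz
  have hterm : ∀ u : ℤ, Complex.exp (-Complex.I * ((2 * Real.pi * q / n : ℝ) : ℂ) * u) = z ^ u := by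
    intro u; rw [hz, ← Complex.exp_int_mul]; congr 1; ring
  have hzn : z ^ n = 1 := by
    rw [hz, ← Complex.exp_nat_mul, Complex.exp_eq_one_iff]
    exact ⟨-q, by push_cast; field_simp⟩
  have hz1 : z = 1 ↔ (n : ℤ) ∣ q := by
    rw [hz, Complex.exp_eq_one_iff]
    constructor
    · rintro ⟨k, hk⟩
      refine ⟨-k, ?_⟩
      have h2 : (2 * Real.pi * Complex.I : ℂ) ≠ 0 := by simp [Real.pi_ne_zero]
      have : (q : ℂ) = n * (-k) := by
        push_cast at hk
        have h3 : (2 * Real.pi * Complex.I : ℂ) * (q : ℂ) =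
            (2 * Real.pi * Complex.I : ℂ) * (n * (-k)) := by
          field_simp at hk
          linear_combination (-2 * Real.pi * Complex.I : ℂ) * hk
        exact mul_left_cancel₀ h2 h3
      exact_mod_cast this
    · rintro ⟨k, rfl⟩
      exact ⟨-k, by push_cast; field_simp⟩
  have hsum : ∑ u ∈ Finset.Icc (1 : ℤ) n,
      Complex.exp (-Complex.I * ((2 * Real.pi * q / n : ℝ) : ℂ) * u) =
      ∑ i ∈ Finset.range n, z * z ^ i := by
    refine (Finset.sum_nbij' (fun i : ℕ => (i : ℤ) + 1) (fun u : ℤ => (u - 1).toNat) ?_ ?_ ?_ ?_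
      ?_).symm
    · intro i hi; simp at hi ⊢; omega
    · intro u hu; simp at hu ⊢; omega
    · intro i _; simp
    · intro u hu; simp at hu ⊢; omega
    · intro i _
      rw [hterm, zpow_add_one₀ (Complex.exp_ne_zero _), zpow_natCast, mul_comm]
  rw [hsum, ← Finset.mul_sum]
  split_ifs with h
  · rw [hz1.2 h]; simp
  · have h1 : z ≠ 1 := fun h' => h (hz1.1 h')
    rw [geom_sum_eq h1, hzn]; simp

lemma exp_neg_I_mul_re (x y : ℝ) : (Complex.exp (-Complex.I * x * y)).re = Real.cos (x * y) := by
  rw [show -Complex.I * (x : ℂ) * y = ((-(x * y) : ℝ) : ℂ) * Complex.I by push_cast; ring,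
    Complex.exp_ofReal_mul_I_re, Real.cos_neg]

lemma exp_neg_I_mul_im (x y : ℝ) : (Complex.exp (-Complex.I * x * y)).im = -Real.sin (x * y) := by
  rw [show -Complex.I * (x : ℂ) * y = ((-(x * y) : ℝ) : ℂ) * Complex.I by push_cast; ring,
    Complex.exp_ofReal_mul_I_im, Real.sin_neg]

lemma sum_cos_fourier {n : ℕ} (hn : 0 < n) {q : ℤ} (hq : ¬ (n : ℤ) ∣ q) :
    ∑ u ∈ Finset.Icc (1 : ℤ) n, Real.cos (2 * Real.pi * q / n * u) = 0 := by
  have := congrArg Complex.re (sum_exp_fourier hn q)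
  rw [if_neg hq, Complex.re_sum] at this
  rw [← Complex.zero_re, ← this]
  refine Finset.sum_congr rfl fun u _ => ?_
  rw [← exp_neg_I_mul_re]; push_cast; rfl

lemma sum_sin_fourier {n : ℕ} (hn : 0 < n) {q : ℤ} (hq : ¬ (n : ℤ) ∣ q) :
    ∑ u ∈ Finset.Icc (1 : ℤ) n, Real.sin (2 * Real.pi * q / n * u) = 0 := by
  have := congrArg Complex.im (sum_exp_fourier hn q)
  rw [if_neg hq, Complex.im_sum] at this
  rw [← neg_eq_zero, ← Complex.zero_im, ← this, ← Finset.sum_neg_distrib]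
  refine Finset.sum_congr rfl fun u _ => ?_
  rw [← exp_neg_I_mul_im]; push_cast; rfl

/-- The pair (h, t) corresponds to (u, t) with u = t + h; the constraint |h| < n is automatic for u,
t in {1, …, n}. -/
lemma sum_lag_eq_sum_sum (n : ℕ) (F : ℤ → ℤ → ℝ) :
    ∑ h ∈ Finset.Ioo (-(n : ℤ)) n,
      ∑ t ∈ (Finset.Icc (1 : ℤ) n).filter (fun t => t + h ∈ Finset.Icc (1 : ℤ) n), F (t + h) t =
    ∑ t ∈ Finset.Icc (1 : ℤ) n, ∑ u ∈ Finset.Icc (1 : ℤ) n, F u t := by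
  simp only [Finset.sum_filter]
  rw [Finset.sum_comm]
  refine Finset.sum_congr rfl fun t ht => ?_
  rw [← Finset.sum_filter]
  rw [Finset.mem_Icc] at ht
  refine Finset.sum_nbij' (fun h => t + h) (fun u => u - t) ?_ ?_ ?_ ?_ ?_
  · intro h hh; exact (Finset.mem_filter.1 hh).2
  · intro u hu
    rw [Finset.mem_filter, Finset.mem_Ioo, Finset.mem_Icc]
    rw [Finset.mem_Icc] at hu
    omega
  · intro h _; simp
  · intro u _; simp
  · intro h _; rfl

variable {Ω : Type*} {m : ℕ} {X : ℤ → Ω → Fin m → ℝ}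

/-- Expanding cos(w(u - t)) separates the double sum into a cosine product and a sine product, so
only products of real linear forms remain. -/
lemma periodogram_re (n : ℕ) (ω : Ω) (w : ℝ) (j k : Fin m) :
    (periodogram X n ω w j k).re = (2 * Real.pi * n)⁻¹ *
      ((∑ u ∈ Finset.Icc (1 : ℤ) n, Real.cos (w * u) * (X u ω j - sampleMean X n ω j)) *
        (∑ t ∈ Finset.Icc (1 : ℤ) n, Real.cos (w * t) * (X t ω k - sampleMean X n ω k)) +
      (∑ u ∈ Finset.Icc (1 : ℤ) n, Real.sin (w * u) * (X u ω j - sampleMean X n ω j)) *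
        (∑ t ∈ Finset.Icc (1 : ℤ) n, Real.sin (w * t) * (X t ω k - sampleMean X n ω k))) := by
  have h1 : (periodogram X n ω w j k).re = (2 * Real.pi)⁻¹ *
      ∑ h ∈ Finset.Ioo (-(n : ℤ)) (n : ℤ), Real.cos (w * h) * sampleAutocov X n ω j k h := by
    simp only [periodogram, Matrix.of_apply]
    rw [show (2 * (Real.pi : ℂ))⁻¹ = (((2 * Real.pi)⁻¹ : ℝ) : ℂ) by push_cast; rfl,
      Complex.re_ofReal_mul, Complex.re_sum]
    congr 1
    refine Finset.sum_congr rfl fun h _ => ?_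
    rw [Complex.re_mul_ofReal, ← exp_neg_I_mul_re]; push_cast; rfl
  have h2 : ∑ h ∈ Finset.Ioo (-(n : ℤ)) (n : ℤ), Real.cos (w * h) * sampleAutocov X n ω j k h =
      (n : ℝ)⁻¹ * ∑ t ∈ Finset.Icc (1 : ℤ) n, ∑ u ∈ Finset.Icc (1 : ℤ) n,
        Real.cos (w * u - w * t) * ((X u ω j - sampleMean X n ω j) *
          (X t ω k - sampleMean X n ω k)) := by
    rw [← sum_lag_eq_sum_sum n fun u t => Real.cos (w * u - w * t) *
      ((X u ω j - sampleMean X n ω j) * (X t ω k - sampleMean X n ω k)), Finset.mul_sum]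
    refine Finset.sum_congr rfl fun h _ => ?_
    rw [sampleAutocov, mul_left_comm, Finset.mul_sum]
    congr 1
    refine Finset.sum_congr rfl fun t _ => ?_
    congr 2; push_cast; ring
  rw [h1, h2, mul_inv _ (n : ℝ), mul_assoc]
  congr 2
  rw [Finset.sum_mul_sum, Finset.sum_mul_sum, ← Finset.sum_add_distrib, Finset.sum_comm]
  refine Finset.sum_congr rfl fun t _ => ?_
  rw [← Finset.sum_add_distrib]
  refine Finset.sum_congr rfl fun u _ => ?_
  rw [Real.cos_sub]; ring

/-- The cosine sequence at the `s`-th Fourier frequency. -/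
noncomputable def cosSeq (n : ℕ) (s : ℤ) (t : ℤ) : ℝ := Real.cos (2 * Real.pi * s / n * t)

/-- The sine sequence at the `s`-th Fourier frequency. -/
noncomputable def sinSeq (n : ℕ) (s : ℤ) (t : ℤ) : ℝ := Real.sin (2 * Real.pi * s / n * t)

variable [MeasurableSpace Ω] {P : Measure Ω}

/-- Coefficients of sum zero annihilate constants, so centering at the sample mean and at the true
mean, which is the same for all t, give the same result. -/
lemma sum_mul_sub_sampleMean (hstat : IsStrictlyStationary X P) (n : ℕ) (ω : Ω) (j : Fin m)
    {a : ℤ → ℝ} (ha : ∑ t ∈ Finset.Icc (1 : ℤ) n, a t = 0) :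
    ∑ t ∈ Finset.Icc (1 : ℤ) n, a t * (X t ω j - sampleMean X n ω j) = linComb X P n a j ω := by
  simp only [linComb, mul_sub, Finset.sum_sub_distrib, ← Finset.sum_mul, ha,
    integral_component_eq hstat, zero_mul]

/-- Away from frequency zero, the periodogram at a Fourier frequency is not affected by the
centering at the sample mean. -/
lemma periodogram_fourier_re (hstat : IsStrictlyStationary X P) {n : ℕ} (hn : 0 < n) {s : ℤ}
    (hs : ¬ (n : ℤ) ∣ s) (ω : Ω) (j k : Fin m) :
    (periodogram X n ω (2 * Real.pi * s / n) j k).re = (2 * Real.pi * n)⁻¹ *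
      (linComb X P n (cosSeq n s) j ω * linComb X P n (cosSeq n s) k ω +
        linComb X P n (sinSeq n s) j ω * linComb X P n (sinSeq n s) k ω) := by
  have hc : ∑ t ∈ Finset.Icc (1 : ℤ) n, cosSeq n s t = 0 := sum_cos_fourier hn hs
  have hs' : ∑ t ∈ Finset.Icc (1 : ℤ) n, sinSeq n s t = 0 := sum_sin_fourier hn hs
  rw [periodogram_re, ← sum_mul_sub_sampleMean hstat n ω j hc,
    ← sum_mul_sub_sampleMean hstat n ω k hc, ← sum_mul_sub_sampleMean hstat n ω j hs',
    ← sum_mul_sub_sampleMean hstat n ω k hs']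
  rfl

/-- Gaussian components have fourth moments, so their products are square integrable. The frequency
is arbitrary because the second moment of the estimator is claimed for every n, including small n
where the Fourier-frequency formula may fail. -/
lemma memLp_periodogram_re (hgauss : IsGaussianProcess X P) (n : ℕ) (w : ℝ) (j k : Fin m) :
    MemLp (fun ω => (periodogram X n ω w j k).re) 2 P := by
  have hX : ∀ (t : ℤ) (j : Fin m), MemLp (fun ω => X t ω j) 4 P := fun t j =>
    ((hgauss.hasGaussianLaw_eval t).map_fun
      (ContinuousLinearMap.proj (R := ℝ) (φ := fun _ : Fin m => ℝ) j)).memLp (by simp)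
  have hsum : ∀ (a : ℤ → ℝ) (j : Fin m), MemLp (fun ω =>
      ∑ u ∈ Finset.Icc (1 : ℤ) n, a u * (X u ω j - sampleMean X n ω j)) 4 P := fun a j =>
    memLp_finsetSum _ fun u _ => (MemLp.sub (hX u j)
      ((memLp_finsetSum (Finset.Icc (1 : ℤ) n) fun t _ => hX t j).const_mul _)).const_mul _
  have : ENNReal.HolderTriple 4 4 2 := ⟨by
    rw [show (4 : ENNReal) = 2 * 2 by norm_num, ENNReal.mul_inv (by simp) (by simp), ← mul_add,
      ENNReal.inv_two_add_inv_two, mul_one]⟩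
  simp only [periodogram_re]
  exact (((hsum _ k).mul' (hsum _ j)).add ((hsum _ k).mul' (hsum _ j))).const_mul _

end Periodogram

/-! ### Toeplitz forms at Fourier frequencies -/

section SpectralSums

lemma card_filter_shift_le (n : ℕ) (h : ℤ) :
    ((Finset.Icc (1 : ℤ) n).filter fun u => ¬ u + h ∈ Finset.Icc (1 : ℤ) n).card ≤ h.natAbs := by
  rcases le_total 0 h with hh | hh
  · calc _ ≤ (Finset.Ioc ((n : ℤ) - h) n).card := by
          apply Finset.card_le_card
          intro u hu
          simp only [Finset.mem_filter, Finset.mem_Icc, Finset.mem_Ioc] at hu ⊢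
          omega
      _ = h.natAbs := by rw [Int.card_Ioc]; omega
  · calc _ ≤ (Finset.Icc 1 (-h)).card := by
          apply Finset.card_le_card
          intro u hu
          simp only [Finset.mem_filter, Finset.mem_Icc] at hu ⊢
          omega
      _ = h.natAbs := by rw [Int.card_Icc]; omega

lemma tsum_shift_indicator (g : ℤ → ℂ) (n : ℕ) (u : ℤ) :
    ∑ t ∈ Finset.Icc (1 : ℤ) n, g (t - u) =
      ∑' h : ℤ, if u + h ∈ Finset.Icc (1 : ℤ) n then g h else 0 := by
  rw [← (Equiv.subRight u).tsum_eq (fun h : ℤ =>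
    if u + h ∈ Finset.Icc (1 : ℤ) n then g h else 0)]
  simp only [Equiv.subRight_apply, add_sub_cancel]
  rw [tsum_eq_sum (s := Finset.Icc (1 : ℤ) n) fun t ht => if_neg ht]
  exact Finset.sum_congr rfl fun t ht => (if_pos ht).symm

/-- The Toeplitz form of a summable sequence at Fourier frequencies, up to a bounded error. -/
lemma norm_toeplitz_sub_le {γ : ℤ → ℝ} (hγ : Summable γ)
    (hγ1 : Summable fun h : ℤ => |(h : ℝ)| * |γ h|) {n : ℕ} (hn : 0 < n) (s r : ℤ) :
    ‖∑ t ∈ Finset.Icc (1 : ℤ) n, ∑ u ∈ Finset.Icc (1 : ℤ) n,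
        Complex.exp (-Complex.I * ((2 * Real.pi * s / n : ℝ) : ℂ) * t) *
        Complex.exp (Complex.I * ((2 * Real.pi * r / n : ℝ) : ℂ) * u) * (γ (t - u) : ℂ) -
      (if (n : ℤ) ∣ s - r then (n : ℂ) else 0) *
        ∑' h : ℤ, Complex.exp (-Complex.I * ((2 * Real.pi * s / n : ℝ) : ℂ) * h) * (γ h : ℂ)‖ ≤
      ∑' h : ℤ, |(h : ℝ)| * |γ h| := by
  set g : ℤ → ℂ := fun h =>
    Complex.exp (-Complex.I * ((2 * Real.pi * s / n : ℝ) : ℂ) * h) * (γ h : ℂ) with hg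
  set e : ℤ → ℂ := fun u =>
    Complex.exp (-Complex.I * ((2 * Real.pi * (s - r : ℤ) / n : ℝ) : ℂ) * u) with he
  have hgn : ∀ h, ‖g h‖ = |γ h| := fun h => by
    have := norm_exp_I_mul_mul (2 * Real.pi * s / n) h
    rw [Complex.ofReal_intCast] at this
    simp only [hg]
    rw [norm_mul, this, one_mul, Complex.norm_real, Real.norm_eq_abs]
  have hen : ∀ u, ‖e u‖ = 1 := fun u => by
    have := norm_exp_I_mul_mul (2 * Real.pi * (s - r : ℤ) / n) u
    rwa [Complex.ofReal_intCast] at this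
  have hgs : Summable g := Summable.of_norm (by simpa only [hgn] using hγ.abs)
  -- With h = t - u the two phases become e^{-iw_s h} times e^{-i(w_s - w_r)u}; the sum of the
  -- latter over u is n or 0.
  have hterm : ∀ u : ℤ, ∑ t ∈ Finset.Icc (1 : ℤ) n,
      Complex.exp (-Complex.I * ((2 * Real.pi * s / n : ℝ) : ℂ) * t) *
        Complex.exp (Complex.I * ((2 * Real.pi * r / n : ℝ) : ℂ) * u) * (γ (t - u) : ℂ) =
      e u * ∑ t ∈ Finset.Icc (1 : ℤ) n, g (t - u) := by
    intro u
    rw [Finset.mul_sum]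
    refine Finset.sum_congr rfl fun t _ => ?_
    simp only [hg, he]
    rw [← mul_assoc, ← Complex.exp_add, ← Complex.exp_add]
    congr 2; push_cast; ring
  have hD : (if (n : ℤ) ∣ s - r then (n : ℂ) else 0) = ∑ u ∈ Finset.Icc (1 : ℤ) n, e u :=
    (sum_exp_fourier hn (s - r)).symm
  have hind : ∀ u : ℤ, Summable fun h : ℤ => if u + h ∈ Finset.Icc (1 : ℤ) n then g h else 0 :=
    fun u => Summable.of_norm_bounded hγ.abs fun h => by
      split_ifs
      · exact (hgn h).le
      · simp
  have hind' : ∀ u : ℤ, Summable fun h : ℤ =>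
      if u + h ∈ Finset.Icc (1 : ℤ) n then (0 : ℝ) else |γ h| :=
    fun u => Summable.of_norm_bounded hγ.abs fun h => by split_ifs <;> simp
  rw [Finset.sum_comm, Finset.sum_congr rfl fun u _ => hterm u, hD, Finset.sum_mul,
    ← Finset.sum_sub_distrib]
  -- Replacing each inner sum by the full series costs the lags h with u + h outside the sample.
  -- After exchanging the sums, a given h is missed by at most |h| values of u.
  calc _ ≤ ∑ u ∈ Finset.Icc (1 : ℤ) n,
        ∑' h : ℤ, if u + h ∈ Finset.Icc (1 : ℤ) n then (0 : ℝ) else |γ h| := by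
        refine (norm_sum_le _ _).trans (Finset.sum_le_sum fun u _ => ?_)
        rw [← mul_sub, norm_mul, hen, one_mul, tsum_shift_indicator,
          ← (hind u).tsum_sub hgs]
        refine tsum_of_norm_bounded (hind' u).hasSum fun h => ?_
        split_ifs
        · simp
        · simp [hgn]
    _ = ∑' h : ℤ, ∑ u ∈ Finset.Icc (1 : ℤ) n,
          if u + h ∈ Finset.Icc (1 : ℤ) n then (0 : ℝ) else |γ h| :=
        (Summable.tsum_finsetSum fun u _ => hind' u).symm
    _ ≤ _ := by
        refine Summable.tsum_le_tsum (fun h => ?_) (summable_sum fun u _ => hind' u) hγ1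
        have : ∑ u ∈ Finset.Icc (1 : ℤ) n,
            (if u + h ∈ Finset.Icc (1 : ℤ) n then (0 : ℝ) else |γ h|) =
            (((Finset.Icc (1 : ℤ) n).filter fun u => ¬ u + h ∈ Finset.Icc (1 : ℤ) n).card : ℝ)
              * |γ h| := by
          rw [← nsmul_eq_mul, ← Finset.sum_const, Finset.sum_filter]
          refine Finset.sum_congr rfl fun u _ => ?_
          by_cases hu : u + h ∈ Finset.Icc (1 : ℤ) n <;> simp only [hu, if_true, if_false,
            not_true, not_false_eq_true]
        rw [this]
        gcongr
        have := card_filter_shift_le n h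
        rw [← Int.cast_abs, Int.abs_eq_natAbs]
        exact_mod_cast this

end SpectralSums

/-! ### Covariances of the cosine and sine transforms -/

section CovarianceAsymptotics

variable {Ω : Type*} [MeasurableSpace Ω] {m : ℕ} {X : ℤ → Ω → Fin m → ℝ} {P : Measure Ω}

lemma summable_abs_mul_autocov (hA : AssumptionA X P 4) (j k : Fin m) :
    Summable fun h : ℤ => |(h : ℝ)| * |autocov X P j k h| :=
  summable_abs_mul_of_contDiff (hA j k).1 ((hA j k).2.of_le (by norm_num))

/-- A common bound for the first absolute moments of the autocovariances. -/
noncomputable def lagMoment (X : ℤ → Ω → Fin m → ℝ) (P : Measure Ω) : ℝ :=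
  ∑ j, ∑ k, ∑' h : ℤ, |(h : ℝ)| * |autocov X P j k h|

lemma lagMoment_nonneg : 0 ≤ lagMoment X P :=
  Finset.sum_nonneg fun _ _ => Finset.sum_nonneg fun _ _ => tsum_nonneg fun _ => by positivity

lemma tsum_le_lagMoment (j k : Fin m) :
    ∑' h : ℤ, |(h : ℝ)| * |autocov X P j k h| ≤ lagMoment X P := by
  have h0 : ∀ j k : Fin m, 0 ≤ ∑' h : ℤ, |(h : ℝ)| * |autocov X P j k h| :=
    fun _ _ => tsum_nonneg fun _ => by positivity
  refine (Finset.single_le_sum (f := fun k => ∑' h : ℤ, |(h : ℝ)| * |autocov X P j k h|)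
    (fun k _ => h0 j k) (Finset.mem_univ k)).trans ?_
  exact Finset.single_le_sum
    (f := fun j => ∑ k, ∑' h : ℤ, |(h : ℝ)| * |autocov X P j k h|)
    (fun j _ => Finset.sum_nonneg fun k _ => h0 j k) (Finset.mem_univ j)

lemma norm_toeplitz_autocov_sub_le (hA : AssumptionA X P 4) {n : ℕ} (hn : 0 < n) (s r : ℤ)
    (j k : Fin m) :
    ‖∑ t ∈ Finset.Icc (1 : ℤ) n, ∑ u ∈ Finset.Icc (1 : ℤ) n,
        Complex.exp (-Complex.I * ((2 * Real.pi * s / n : ℝ) : ℂ) * t) *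
        Complex.exp (Complex.I * ((2 * Real.pi * r / n : ℝ) : ℂ) * u) *
          (autocov X P j k (t - u) : ℂ) -
      ((n * (if (n : ℤ) ∣ s - r then 1 else 0) : ℝ) : ℂ) *
        (2 * Real.pi * specDensity X P (2 * Real.pi * s / n) j k)‖ ≤ lagMoment X P := by
  refine le_trans (le_of_eq ?_) ((norm_toeplitz_sub_le (hA j k).1
    (summable_abs_mul_autocov hA j k) hn s r).trans (tsum_le_lagMoment j k))
  congr 2
  have hpi : (2 * (Real.pi : ℂ)) ≠ 0 := by simp [Real.pi_ne_zero]
  congr 1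
  · split_ifs <;> simp
  · simp only [specDensity, Matrix.of_apply]
    rw [← mul_assoc, mul_inv_cancel₀ hpi, one_mul]

lemma toeplitz_re (γ : ℤ → ℝ) (n : ℕ) (s r : ℤ) :
    (∑ t ∈ Finset.Icc (1 : ℤ) n, ∑ u ∈ Finset.Icc (1 : ℤ) n,
        Complex.exp (-Complex.I * ((2 * Real.pi * s / n : ℝ) : ℂ) * t) *
        Complex.exp (Complex.I * ((2 * Real.pi * r / n : ℝ) : ℂ) * u) * (γ (t - u) : ℂ)).re =
      (∑ t ∈ Finset.Icc (1 : ℤ) n, ∑ u ∈ Finset.Icc (1 : ℤ) n,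
        cosSeq n s t * cosSeq n r u * γ (t - u)) +
      ∑ t ∈ Finset.Icc (1 : ℤ) n, ∑ u ∈ Finset.Icc (1 : ℤ) n,
        sinSeq n s t * sinSeq n r u * γ (t - u) := by
  rw [Complex.re_sum, ← Finset.sum_add_distrib]
  refine Finset.sum_congr rfl fun t _ => ?_
  rw [Complex.re_sum, ← Finset.sum_add_distrib]
  refine Finset.sum_congr rfl fun u _ => ?_
  have := exp_neg_I_mul_re 1 (2 * Real.pi * s / n * t - 2 * Real.pi * r / n * u)
  rw [← add_mul, cosSeq, cosSeq, sinSeq, sinSeq, ← Real.cos_sub, ← Complex.exp_add,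
    Complex.re_mul_ofReal, ← one_mul (2 * Real.pi * s / n * t - 2 * Real.pi * r / n * u), ← this]
  congr 3; push_cast; ring

lemma toeplitz_im (γ : ℤ → ℝ) (n : ℕ) (s r : ℤ) :
    (∑ t ∈ Finset.Icc (1 : ℤ) n, ∑ u ∈ Finset.Icc (1 : ℤ) n,
        Complex.exp (-Complex.I * ((2 * Real.pi * s / n : ℝ) : ℂ) * t) *
        Complex.exp (Complex.I * ((2 * Real.pi * r / n : ℝ) : ℂ) * u) * (γ (t - u) : ℂ)).im =
      (∑ t ∈ Finset.Icc (1 : ℤ) n, ∑ u ∈ Finset.Icc (1 : ℤ) n,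
        cosSeq n s t * sinSeq n r u * γ (t - u)) -
      ∑ t ∈ Finset.Icc (1 : ℤ) n, ∑ u ∈ Finset.Icc (1 : ℤ) n,
        sinSeq n s t * cosSeq n r u * γ (t - u) := by
  rw [Complex.im_sum, ← Finset.sum_sub_distrib]
  refine Finset.sum_congr rfl fun t _ => ?_
  rw [Complex.im_sum, ← Finset.sum_sub_distrib]
  refine Finset.sum_congr rfl fun u _ => ?_
  have := exp_neg_I_mul_im 1 (2 * Real.pi * s / n * t - 2 * Real.pi * r / n * u)
  rw [one_mul, Real.sin_sub, neg_sub] at this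
  rw [← sub_mul, cosSeq, cosSeq, sinSeq, sinSeq, ← Complex.exp_add, Complex.im_mul_ofReal, ← this]
  congr 3; push_cast; ring

lemma cosSeq_neg (n : ℕ) (r : ℤ) : cosSeq n (-r) = cosSeq n r := by
  ext t; rw [cosSeq, cosSeq, ← Real.cos_neg]; congr 1; push_cast; ring

lemma sinSeq_neg (n : ℕ) (r t : ℤ) : sinSeq n (-r) t = -sinSeq n r t := by
  rw [sinSeq, sinSeq, ← Real.sin_neg]; congr 1; push_cast; ring

/-- The Toeplitz form at (s, r) yields cc + ss and cs - sc as its real and imaginary parts; at (s,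
-r) it yields cc - ss and -(cs + sc). Half sums and half differences isolate the four moments
without enlarging the error bound. The indicator D' matters when r = s and 2s is a multiple of n. -/
lemma linComb_fourier_covariances (hstat : IsStrictlyStationary X P)
    (hgauss : IsGaussianProcess X P) (hA : AssumptionA X P 4) {n : ℕ} (hn : 0 < n) (s r : ℤ)
    (j k : Fin m) {D D' : ℝ} (hD : D = if (n : ℤ) ∣ s - r then 1 else 0)
    (hD' : D' = if (n : ℤ) ∣ s + r then 1 else 0) {z : ℂ}
    (hz : z = 2 * Real.pi * specDensity X P (2 * Real.pi * s / n) j k) :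
    |∫ ω, linComb X P n (cosSeq n s) j ω * linComb X P n (cosSeq n r) k ω ∂P -
        n * ((D + D') / 2 * z.re)| ≤ lagMoment X P ∧
    |∫ ω, linComb X P n (sinSeq n s) j ω * linComb X P n (sinSeq n r) k ω ∂P -
        n * ((D - D') / 2 * z.re)| ≤ lagMoment X P ∧
    |∫ ω, linComb X P n (cosSeq n s) j ω * linComb X P n (sinSeq n r) k ω ∂P -
        n * ((D - D') / 2 * z.im)| ≤ lagMoment X P ∧
    |∫ ω, linComb X P n (sinSeq n s) j ω * linComb X P n (cosSeq n r) k ω ∂P -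
        n * (-((D + D') / 2 * z.im))| ≤ lagMoment X P := by
  have h1 := norm_toeplitz_autocov_sub_le hA hn s r j k
  have h2 := norm_toeplitz_autocov_sub_le hA hn s (-r) j k
  rw [sub_neg_eq_add] at h2
  rw [← hD, ← hz] at h1
  rw [← hD', ← hz] at h2
  have r1 := (Complex.abs_re_le_norm _).trans h1
  have i1 := (Complex.abs_im_le_norm _).trans h1
  have r2 := (Complex.abs_re_le_norm _).trans h2
  have i2 := (Complex.abs_im_le_norm _).trans h2
  rw [Complex.sub_re, Complex.re_ofReal_mul, toeplitz_re] at r1 r2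
  rw [Complex.sub_im, Complex.im_ofReal_mul, toeplitz_im] at i1 i2
  simp only [cosSeq_neg, sinSeq_neg, mul_neg, neg_mul, Finset.sum_neg_distrib] at r2 i2
  simp only [← integral_linComb_mul hstat hgauss] at r1 r2 i1 i2
  rw [abs_le] at r1 r2 i1 i2
  simp only [abs_le]
  refine ⟨⟨?_, ?_⟩, ⟨?_, ?_⟩, ⟨?_, ?_⟩, ⟨?_, ?_⟩⟩ <;> linarith

/-- The asymptotic variance of the real part of a periodogram ordinate. -/
noncomputable def asympVar (X : ℤ → Ω → Fin m → ℝ) (P : Measure Ω) (j k : Fin m) (w : ℝ) : ℝ :=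
  ((specDensity X P w j j).re * (specDensity X P w k k).re + (specDensity X P w j k).re ^ 2
    - (specDensity X P w j k).im ^ 2) / 2

lemma specDensity_swap (hstat : IsStrictlyStationary X P) (w : ℝ) (j k : Fin m) :
    specDensity X P w k j = (starRingEnd ℂ) (specDensity X P w j k) := by
  simp only [specDensity, Matrix.of_apply]
  rw [map_mul, map_inv₀, map_mul, Complex.conj_ofReal, Complex.conj_tsum,
    ← (Equiv.neg ℤ).tsum_eq]
  congr 1
  · rw [map_ofNat]
  · congr 1; ext h
    rw [map_mul, ← Complex.exp_conj, Complex.conj_ofReal, Equiv.neg_apply, autocov_neg hstat]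
    congr 2
    simp

lemma specDensity_self_im (hstat : IsStrictlyStationary X P) (w : ℝ) (j : Fin m) :
    (specDensity X P w j j).im = 0 :=
  Complex.conj_eq_iff_im.1 (specDensity_swap hstat w j j).symm

lemma specDensity_neg (X : ℤ → Ω → Fin m → ℝ) (P : Measure Ω) (w : ℝ) (j k : Fin m) :
    specDensity X P (-w) j k = (starRingEnd ℂ) (specDensity X P w j k) := by
  simp only [specDensity, Matrix.of_apply]
  rw [map_mul, map_inv₀, map_mul, Complex.conj_ofReal, Complex.conj_tsum]
  congr 1
  · rw [map_ofNat]
  · congr 1; ext h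
    rw [map_mul, ← Complex.exp_conj, Complex.conj_ofReal]
    congr 2
    simp

lemma specDensity_add_two_pi (X : ℤ → Ω → Fin m → ℝ) (P : Measure Ω) (w : ℝ) (j k : Fin m) :
    specDensity X P (w + 2 * Real.pi) j k = specDensity X P w j k := by
  simp only [specDensity, Matrix.of_apply]
  congr 2; ext h; congr 1
  rw [Complex.exp_eq_exp_iff_exists_int]
  exact ⟨-h, by push_cast; ring⟩

/-- A common bound for the entries of the spectral density matrix, scaled by `2π`. -/
noncomputable def spectralBound (X : ℤ → Ω → Fin m → ℝ) (P : Measure Ω) : ℝ :=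
  ∑ j, ∑ k, ∑' h : ℤ, |autocov X P j k h|

lemma spectralBound_nonneg : 0 ≤ spectralBound X P :=
  Finset.sum_nonneg fun _ _ => Finset.sum_nonneg fun _ _ => tsum_nonneg fun _ => abs_nonneg _

lemma norm_specDensity_le (hA : AssumptionA X P 4) (w : ℝ) (j k : Fin m) :
    ‖2 * Real.pi * specDensity X P w j k‖ ≤ spectralBound X P := by
  have hpi : (2 * (Real.pi : ℂ)) ≠ 0 := by simp [Real.pi_ne_zero]
  have h0 : ∀ j k : Fin m, 0 ≤ ∑' h : ℤ, |autocov X P j k h| :=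
    fun _ _ => tsum_nonneg fun _ => abs_nonneg _
  have h1 : ∑' h : ℤ, |autocov X P j k h| ≤ spectralBound X P := by
    refine (Finset.single_le_sum (f := fun k => ∑' h : ℤ, |autocov X P j k h|)
      (fun k _ => h0 j k) (Finset.mem_univ k)).trans ?_
    exact Finset.single_le_sum (f := fun j => ∑ k, ∑' h : ℤ, |autocov X P j k h|)
      (fun j _ => Finset.sum_nonneg fun k _ => h0 j k) (Finset.mem_univ j)
  refine le_trans ?_ h1
  simp only [specDensity, Matrix.of_apply]
  rw [← mul_assoc, mul_inv_cancel₀ hpi, one_mul]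
  refine tsum_of_norm_bounded (hA j k).1.abs.hasSum fun h => ?_
  have := norm_exp_I_mul_mul w h
  rw [Complex.ofReal_intCast] at this
  rw [norm_mul, this, one_mul, Complex.norm_real, Real.norm_eq_abs]

end CovarianceAsymptotics

/-! ### Means and covariances of periodogram ordinates -/

section PeriodogramMoments

lemma abs_mul_sub_sq_mul_le {x y a b n F R : ℝ} (hn : 1 ≤ n) (hF : 0 ≤ F) (hR : 0 ≤ R)
    (hx : |x - n * a| ≤ R) (hy : |y - n * b| ≤ R) (ha : |a| ≤ F) (hb : |b| ≤ F) :
    |x * y - n ^ 2 * (a * b)| ≤ n * (R * (2 * F + R)) := by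
  have h : x * y - n ^ 2 * (a * b) =
      (x - n * a) * (y - n * b) + n * (a * (y - n * b)) + n * (b * (x - n * a)) := by ring
  rw [h]
  have h1 : |(x - n * a) * (y - n * b)| ≤ R * R := by
    rw [abs_mul]; exact mul_le_mul hx hy (abs_nonneg _) hR
  have h2 : |n * (a * (y - n * b))| ≤ n * (F * R) := by
    rw [abs_mul, abs_mul, abs_of_nonneg (by linarith : 0 ≤ n)]
    gcongr
  have h3 : |n * (b * (x - n * a))| ≤ n * (F * R) := by
    rw [abs_mul, abs_mul, abs_of_nonneg (by linarith : 0 ≤ n)]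
    gcongr
  have h4 : R * R ≤ n * (R * R) := le_mul_of_one_le_left (by positivity) hn
  calc _ ≤ R * R + n * (F * R) + n * (F * R) :=
        (abs_add_le _ _).trans (add_le_add ((abs_add_le _ _).trans (add_le_add h1 h2)) h3)
    _ ≤ _ := by linarith

/-- The 8 counts the products in `covariance_periodogram_re`; it is absorbed by (2π)². -/
lemma inv_two_pi_mul_sq_mul_le {n B : ℝ} (hn : 0 < n) (hB : 0 ≤ B) :
    ((2 * Real.pi * n)⁻¹) ^ 2 * (8 * B) ≤ B * n⁻¹ ^ 2 := by
  have hpi := Real.pi_gt_three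
  rw [mul_inv, mul_pow]
  have : ((2 * Real.pi)⁻¹) ^ 2 * 8 ≤ 1 := by
    rw [inv_pow, inv_mul_le_iff₀ (by positivity)]
    nlinarith
  calc _ = ((2 * Real.pi)⁻¹ ^ 2 * 8) * (B * n⁻¹ ^ 2) := by ring
    _ ≤ 1 * (B * n⁻¹ ^ 2) := by gcongr
    _ = _ := one_mul _

lemma abs_sum_eight_le {a₁ a₂ a₃ a₄ a₅ a₆ a₇ a₈ B : ℝ} (h₁ : |a₁| ≤ B) (h₂ : |a₂| ≤ B)
    (h₃ : |a₃| ≤ B) (h₄ : |a₄| ≤ B) (h₅ : |a₅| ≤ B) (h₆ : |a₆| ≤ B) (h₇ : |a₇| ≤ B)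
    (h₈ : |a₈| ≤ B) :
    |(a₁ + a₂) + (a₃ + a₄) + ((a₅ + a₆) + (a₇ + a₈))| ≤ 8 * B := by
  rw [abs_le] at *
  constructor <;> linarith

variable {Ω : Type*} [MeasurableSpace Ω] {m : ℕ} {X : ℤ → Ω → Fin m → ℝ} {P : Measure Ω}

/-- Mixed second moments of the linear combinations `linComb`. -/
noncomputable def crossMoment (X : ℤ → Ω → Fin m → ℝ) (P : Measure Ω) (n : ℕ) (a b : ℤ → ℝ)
    (j k : Fin m) : ℝ :=
  ∫ ω, linComb X P n a j ω * linComb X P n b k ω ∂P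

/-- Each ordinate is a cosine product plus a sine product; bilinearity gives four covariances, and
Isserlis' formula gives two pairings for each. -/
lemma covariance_periodogram_re (hstat : IsStrictlyStationary X P)
    (hgauss : IsGaussianProcess X P) {n : ℕ} (hn : 0 < n) {s r : ℤ}
    (hs : ¬ (n : ℤ) ∣ s) (hr : ¬ (n : ℤ) ∣ r) (j k : Fin m) :
    cov[fun ω => (periodogram X n ω (2 * Real.pi * s / n) j k).re,
        fun ω => (periodogram X n ω (2 * Real.pi * r / n) j k).re; P] =
      ((2 * Real.pi * n)⁻¹) ^ 2 *
      ((crossMoment X P n (cosSeq n s) (cosSeq n r) j j *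
          crossMoment X P n (cosSeq n s) (cosSeq n r) k k +
        crossMoment X P n (cosSeq n s) (cosSeq n r) j k *
          crossMoment X P n (cosSeq n s) (cosSeq n r) k j) +
       (crossMoment X P n (cosSeq n s) (sinSeq n r) j j *
          crossMoment X P n (cosSeq n s) (sinSeq n r) k k +
        crossMoment X P n (cosSeq n s) (sinSeq n r) j k *
          crossMoment X P n (cosSeq n s) (sinSeq n r) k j) +
      ((crossMoment X P n (sinSeq n s) (cosSeq n r) j j *
          crossMoment X P n (sinSeq n s) (cosSeq n r) k k +
        crossMoment X P n (sinSeq n s) (cosSeq n r) j k *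
          crossMoment X P n (sinSeq n s) (cosSeq n r) k j) +
       (crossMoment X P n (sinSeq n s) (sinSeq n r) j j *
          crossMoment X P n (sinSeq n s) (sinSeq n r) k k +
        crossMoment X P n (sinSeq n s) (sinSeq n r) j k *
          crossMoment X P n (sinSeq n s) (sinSeq n r) k j))) := by
  have := hgauss.isProbabilityMeasure
  simp only [periodogram_fourier_re hstat hn hs, periodogram_fourier_re hstat hn hr]
  rw [covariance_const_mul_left, covariance_const_mul_right, ← mul_assoc, ← sq]
  congr 1
  have hL := fun (a : ℤ → ℝ) => memLp_linComb_mul hgauss n a a j k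
  have e1 := covariance_add_left (hL (cosSeq n s)) (hL (sinSeq n s))
    ((hL (cosSeq n r)).add (hL (sinSeq n r)))
  have e2 := covariance_add_right (hL (cosSeq n s)) (hL (cosSeq n r)) (hL (sinSeq n r))
  have e3 := covariance_add_right (hL (sinSeq n s)) (hL (cosSeq n r)) (hL (sinSeq n r))
  refine e1.trans ?_
  rw [e2, e3]
  simp only [covariance_linComb_mul hgauss, crossMoment]

lemma integral_periodogram_re (hstat : IsStrictlyStationary X P)
    (hgauss : IsGaussianProcess X P) {n : ℕ} (hn : 0 < n) {s : ℤ}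
    (hs : ¬ (n : ℤ) ∣ s) (j k : Fin m) :
    ∫ ω, (periodogram X n ω (2 * Real.pi * s / n) j k).re ∂P = (2 * Real.pi * n)⁻¹ *
      (crossMoment X P n (cosSeq n s) (cosSeq n s) j k +
        crossMoment X P n (sinSeq n s) (sinSeq n s) j k) := by
  have := hgauss.isProbabilityMeasure
  simp only [periodogram_fourier_re hstat hn hs]
  rw [integral_const_mul, integral_add ((memLp_linComb_mul hgauss n _ _ j k).integrable (by simp))
    ((memLp_linComb_mul hgauss n _ _ j k).integrable (by simp))]
  rfl

/-- The terms in D' cancel between the cosine and sine moments, so the frequency π needs no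
exception in the mean. -/
lemma abs_integral_periodogram_re_sub_le (hstat : IsStrictlyStationary X P)
    (hgauss : IsGaussianProcess X P) (hA : AssumptionA X P 4) {n : ℕ} (hn : 0 < n) {s : ℤ}
    (hs : ¬ (n : ℤ) ∣ s) (j k : Fin m) :
    |∫ ω, (periodogram X n ω (2 * Real.pi * s / n) j k).re ∂P -
      (specDensity X P (2 * Real.pi * s / n) j k).re| ≤ lagMoment X P * (n : ℝ)⁻¹ := by
  obtain ⟨h1, h2, -, -⟩ := linComb_fourier_covariances hstat hgauss hA hn s s j k rfl rfl rfl
  set D' : ℝ := if (n : ℤ) ∣ s + s then 1 else 0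
  rw [if_pos (by simp)] at h1 h2
  rw [integral_periodogram_re hstat hgauss hn hs]
  change |crossMoment X P n _ _ j k - _| ≤ _ at h1
  change |crossMoment X P n _ _ j k - _| ≤ _ at h2
  set x := crossMoment X P n (cosSeq n s) (cosSeq n s) j k
  set y := crossMoment X P n (sinSeq n s) (sinSeq n s) j k
  set f := specDensity X P (2 * Real.pi * s / n) j k
  have hz : (2 * (Real.pi : ℂ) * f).re = 2 * Real.pi * f.re := by
    rw [show 2 * (Real.pi : ℂ) = ((2 * Real.pi : ℝ) : ℂ) by push_cast; rfl, Complex.re_ofReal_mul]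
  rw [hz] at h1 h2
  have hn' : (0 : ℝ) < n := by exact_mod_cast hn
  have hpi := Real.pi_gt_three
  have h3 : |x + y - 2 * Real.pi * n * f.re| ≤ 2 * lagMoment X P := by
    rw [abs_le] at *
    constructor <;> linarith
  have h4 : (2 * Real.pi * n)⁻¹ * (x + y) - f.re =
      (2 * Real.pi * n)⁻¹ * (x + y - 2 * Real.pi * n * f.re) := by field_simp
  have hR := lagMoment_nonneg (X := X) (P := P)
  rw [h4, abs_mul, abs_of_pos (by positivity)]
  calc _ ≤ (2 * Real.pi * n)⁻¹ * (2 * lagMoment X P) := by gcongr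
    _ = Real.pi⁻¹ * (lagMoment X P * (n : ℝ)⁻¹) := by rw [mul_inv, mul_inv]; ring
    _ ≤ 1 * (lagMoment X P * (n : ℝ)⁻¹) := by
        gcongr; exact inv_le_one_of_one_le₀ (by linarith)
    _ = _ := one_mul _

/-- Both indicators vanish, so every cross moment is bounded uniformly in n and only the prefactor
of order n⁻² remains. -/
lemma abs_covariance_periodogram_re_le_of_ne (hstat : IsStrictlyStationary X P)
    (hgauss : IsGaussianProcess X P) (hA : AssumptionA X P 4) {n : ℕ} (hn : 0 < n) {s r : ℤ}
    (hs : ¬ (n : ℤ) ∣ s) (hr : ¬ (n : ℤ) ∣ r) (hsub : ¬ (n : ℤ) ∣ s - r)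
    (hadd : ¬ (n : ℤ) ∣ s + r) (j k : Fin m) :
    |cov[fun ω => (periodogram X n ω (2 * Real.pi * s / n) j k).re,
        fun ω => (periodogram X n ω (2 * Real.pi * r / n) j k).re; P]| ≤
      lagMoment X P ^ 2 * (n : ℝ)⁻¹ ^ 2 := by
  have hn' : (0 : ℝ) < n := by exact_mod_cast hn
  have hR := lagMoment_nonneg (X := X) (P := P)
  have hb := fun j k => linComb_fourier_covariances hstat hgauss hA hn s r j k
    (if_neg hsub).symm (if_neg hadd).symm rfl
  simp only [add_zero, sub_zero, zero_div, zero_mul, mul_zero, neg_zero] at hb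
  have hp : ∀ x y : ℝ, |x| ≤ lagMoment X P → |y| ≤ lagMoment X P →
      |x * y| ≤ lagMoment X P ^ 2 := fun x y hx hy => by
    rw [abs_mul, sq]; exact mul_le_mul hx hy (abs_nonneg _) hR
  rw [covariance_periodogram_re hstat hgauss hn hs hr, abs_mul,
    abs_of_nonneg (by positivity : 0 ≤ ((2 * Real.pi * n)⁻¹) ^ 2)]
  refine le_trans (mul_le_mul_of_nonneg_left (abs_sum_eight_le (B := lagMoment X P ^ 2)
    ?_ ?_ ?_ ?_ ?_ ?_ ?_ ?_) (by positivity))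
    (inv_two_pi_mul_sq_mul_le hn' (by positivity))
  · exact hp _ _ (hb j j).1 (hb k k).1
  · exact hp _ _ (hb j k).1 (hb k j).1
  · exact hp _ _ (hb j j).2.2.1 (hb k k).2.2.1
  · exact hp _ _ (hb j k).2.2.1 (hb k j).2.2.1
  · exact hp _ _ (hb j j).2.2.2 (hb k k).2.2.2
  · exact hp _ _ (hb j k).2.2.2 (hb k j).2.2.2
  · exact hp _ _ (hb j j).2.1 (hb k k).2.1
  · exact hp _ _ (hb j k).2.1 (hb k j).2.1

/-- A crude bound that also covers 2s divisible by n, that is, the frequency π, where the variance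
does not converge to `asympVar` in general. -/
lemma abs_covariance_periodogram_re_self_le (hstat : IsStrictlyStationary X P)
    (hgauss : IsGaussianProcess X P) (hA : AssumptionA X P 4) {n : ℕ} (hn : 0 < n) {s : ℤ}
    (hs : ¬ (n : ℤ) ∣ s) (j k : Fin m) :
    |cov[fun ω => (periodogram X n ω (2 * Real.pi * s / n) j k).re,
        fun ω => (periodogram X n ω (2 * Real.pi * s / n) j k).re; P]| ≤
      (spectralBound X P + lagMoment X P) ^ 2 := by
  have hn' : (0 : ℝ) < n := by exact_mod_cast hn
  have hn1 : (1 : ℝ) ≤ n := by exact_mod_cast hn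
  have hR := lagMoment_nonneg (X := X) (P := P)
  have hF := spectralBound_nonneg (X := X) (P := P)
  have hb := fun j k => linComb_fourier_covariances hstat hgauss hA hn s s j k rfl rfl rfl
  set D' : ℝ := if (n : ℤ) ∣ s + s then 1 else 0 with hD'
  have hD1 : |(1 + D') / 2| ≤ 1 := by rw [hD']; split_ifs <;> norm_num
  have hD2 : |(1 - D') / 2| ≤ 1 := by rw [hD']; split_ifs <;> norm_num
  simp only [sub_self, dvd_zero, if_true] at hb
  set B := spectralBound X P + lagMoment X P with hB
  have hq : ∀ {x d y : ℝ}, |x - n * (d * y)| ≤ lagMoment X P → |d| ≤ 1 →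
      |y| ≤ spectralBound X P → |x| ≤ n * B := by
    intro x d y h1 h2 h3
    have h4 : |(n : ℝ) * (d * y)| ≤ n * (1 * spectralBound X P) := by
      rw [abs_mul, abs_mul, abs_of_pos hn']; gcongr
    have h5 := abs_sub_abs_le_abs_sub x (n * (d * y))
    have h6 : lagMoment X P ≤ n * lagMoment X P := le_mul_of_one_le_left hR hn1
    rw [hB]; linarith
  have hre := fun j k => (Complex.abs_re_le_norm _).trans
    (norm_specDensity_le hA (2 * Real.pi * s / n) j k)
  have him := fun j k => (Complex.abs_im_le_norm _).trans
    (norm_specDensity_le hA (2 * Real.pi * s / n) j k)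
  have hcc := fun j k => hq (hb j k).1 hD1 (hre j k)
  have hss := fun j k => hq (hb j k).2.1 hD2 (hre j k)
  have hcs := fun j k => hq (hb j k).2.2.1 hD2 (him j k)
  have hsc := fun j k => hq (by rw [neg_mul]; exact (hb j k).2.2.2) ((abs_neg _).le.trans hD1)
    (him j k)
  have hp : ∀ x y : ℝ, |x| ≤ n * B → |y| ≤ n * B → |x * y| ≤ (n * B) ^ 2 := fun x y hx hy => by
    rw [abs_mul, sq]; exact mul_le_mul hx hy (abs_nonneg _) (by positivity)
  rw [covariance_periodogram_re hstat hgauss hn hs hs, abs_mul,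
    abs_of_nonneg (by positivity : 0 ≤ ((2 * Real.pi * n)⁻¹) ^ 2)]
  have hfin : (n * B) ^ 2 * (n : ℝ)⁻¹ ^ 2 = B ^ 2 := by field_simp
  rw [← hfin]
  refine le_trans (mul_le_mul_of_nonneg_left (abs_sum_eight_le (B := (n * B) ^ 2)
    ?_ ?_ ?_ ?_ ?_ ?_ ?_ ?_) (by positivity))
    (inv_two_pi_mul_sq_mul_le hn' (by positivity))
  · exact hp _ _ (hcc j j) (hcc k k)
  · exact hp _ _ (hcc j k) (hcc k j)
  · exact hp _ _ (hcs j j) (hcs k k)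
  · exact hp _ _ (hcs j k) (hcs k j)
  · exact hp _ _ (hsc j j) (hsc k k)
  · exact hp _ _ (hsc j k) (hsc k j)
  · exact hp _ _ (hss j j) (hss k k)
  · exact hp _ _ (hss j k) (hss k j)

lemma abs_covariance_periodogram_re_self_sub_le (hstat : IsStrictlyStationary X P)
    (hgauss : IsGaussianProcess X P) (hA : AssumptionA X P 4) {n : ℕ} (hn : 0 < n) {s : ℤ}
    (hs : ¬ (n : ℤ) ∣ s) (hs2 : ¬ (n : ℤ) ∣ s + s) (j k : Fin m) :
    |cov[fun ω => (periodogram X n ω (2 * Real.pi * s / n) j k).re,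
        fun ω => (periodogram X n ω (2 * Real.pi * s / n) j k).re; P] -
      asympVar X P j k (2 * Real.pi * s / n)| ≤
      lagMoment X P * (2 * spectralBound X P + lagMoment X P) * (n : ℝ)⁻¹ := by
  have hn' : (0 : ℝ) < n := by exact_mod_cast hn
  have hn1 : (1 : ℝ) ≤ n := by exact_mod_cast hn
  have hR := lagMoment_nonneg (X := X) (P := P)
  have hF := spectralBound_nonneg (X := X) (P := P)
  have hb := fun j k => linComb_fourier_covariances hstat hgauss hA hn s s j k rfl
    (if_neg hs2).symm rfl
  simp only [sub_self, dvd_zero, if_true, add_zero, sub_zero] at hb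
  have hre : ∀ j k, |1 / 2 * (2 * (Real.pi : ℂ) * specDensity X P (2 * Real.pi * s / n) j k).re| ≤
      spectralBound X P := fun j k => by
    have := (Complex.abs_re_le_norm _).trans (norm_specDensity_le hA (2 * Real.pi * s / n) j k)
    rw [abs_mul, abs_of_pos (by norm_num : (0 : ℝ) < 1 / 2)]; linarith
  have him : ∀ j k, |1 / 2 * (2 * (Real.pi : ℂ) * specDensity X P (2 * Real.pi * s / n) j k).im| ≤
      spectralBound X P := fun j k => by
    have := (Complex.abs_im_le_norm _).trans (norm_specDensity_le hA (2 * Real.pi * s / n) j k)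
    rw [abs_mul, abs_of_pos (by norm_num : (0 : ℝ) < 1 / 2)]; linarith
  have him' := fun j k => (abs_neg _).le.trans (him j k)
  have hzre : ∀ j k, (2 * (Real.pi : ℂ) * specDensity X P (2 * Real.pi * s / n) j k).re =
      2 * Real.pi * (specDensity X P (2 * Real.pi * s / n) j k).re := fun j k => by
    rw [show 2 * (Real.pi : ℂ) = ((2 * Real.pi : ℝ) : ℂ) by push_cast; rfl, Complex.re_ofReal_mul]
  have hzim : ∀ j k, (2 * (Real.pi : ℂ) * specDensity X P (2 * Real.pi * s / n) j k).im =
      2 * Real.pi * (specDensity X P (2 * Real.pi * s / n) j k).im := fun j k => by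
    rw [show 2 * (Real.pi : ℂ) = ((2 * Real.pi : ℝ) : ℂ) by push_cast; rfl, Complex.im_ofReal_mul]
  have hkj := specDensity_swap hstat (2 * Real.pi * s / n) j k
  have p1 := abs_mul_sub_sq_mul_le hn1 hF hR (hb j j).1 (hb k k).1 (hre j j) (hre k k)
  have p2 := abs_mul_sub_sq_mul_le hn1 hF hR (hb j k).1 (hb k j).1 (hre j k) (hre k j)
  have p3 := abs_mul_sub_sq_mul_le hn1 hF hR (hb j j).2.2.1 (hb k k).2.2.1 (him j j) (him k k)
  have p4 := abs_mul_sub_sq_mul_le hn1 hF hR (hb j k).2.2.1 (hb k j).2.2.1 (him j k) (him k j)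
  have p5 := abs_mul_sub_sq_mul_le hn1 hF hR (hb j j).2.2.2 (hb k k).2.2.2 (him' j j) (him' k k)
  have p6 := abs_mul_sub_sq_mul_le hn1 hF hR (hb j k).2.2.2 (hb k j).2.2.2 (him' j k) (him' k j)
  have p7 := abs_mul_sub_sq_mul_le hn1 hF hR (hb j j).2.1 (hb k k).2.1 (hre j j) (hre k k)
  have p8 := abs_mul_sub_sq_mul_le hn1 hF hR (hb j k).2.1 (hb k j).2.1 (hre j k) (hre k j)
  have hsum := abs_sum_eight_le p1 p2 p3 p4 p5 p6 p7 p8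
  set B := lagMoment X P * (2 * spectralBound X P + lagMoment X P)
  have hB : B * (n : ℝ)⁻¹ = (n * B) * (n : ℝ)⁻¹ ^ 2 := by field_simp
  rw [hB, covariance_periodogram_re hstat hgauss hn hs hs]
  refine le_trans ?_ (inv_two_pi_mul_sq_mul_le hn' (by positivity))
  refine le_trans (le_of_eq ?_) (mul_le_mul_of_nonneg_left hsum
    (by positivity : 0 ≤ ((2 * Real.pi * n)⁻¹) ^ 2))
  rw [← abs_of_nonneg (by positivity : 0 ≤ ((2 * Real.pi * n)⁻¹) ^ 2), ← abs_mul,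
    abs_of_nonneg (by positivity : 0 ≤ ((2 * Real.pi * n)⁻¹) ^ 2)]
  congr 1
  simp only [hzre, hzim]
  -- Hermitian symmetry removes the imaginary parts of the diagonal entries and turns the product of
  -- the (j, k) and (k, j) imaginary parts into a negative square.
  simp only [hkj, Complex.conj_re, Complex.conj_im, asympVar, crossMoment,
    specDensity_self_im hstat]
  have hpi := Real.pi_ne_zero
  field_simp
  ring

end PeriodogramMoments

/-! ### The regression weights -/

section Weights

/-- The offset `c` for which the `i`-th regression frequency is at distance `2π(i + c)/n` from the
boundary point. -/
noncomputable def freqOffset (θ : ℝ) (n : ℕ) : ℝ :=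
  if θ = 0 then 1 else (n : ℝ) / 2 - ((n / 2 : ℕ) : ℝ)

lemma freqOffset_nonneg (θ : ℝ) (n : ℕ) : 0 ≤ freqOffset θ n := by
  unfold freqOffset
  split_ifs
  · exact zero_le_one
  · rw [sub_nonneg]; exact_mod_cast Nat.cast_div_le (α := ℝ) (m := n) (n := 2)

lemma freqOffset_le_one (θ : ℝ) (n : ℕ) : freqOffset θ n ≤ 1 := by
  unfold freqOffset
  split_ifs
  · exact le_rfl
  · have : n ≤ 2 * (n / 2) + 1 := by omega
    have : (n : ℝ) ≤ 2 * ((n / 2 : ℕ) : ℝ) + 1 := by exact_mod_cast this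
    linarith

/-- For θ = ±π the offset is 0 or 1/2 according to the parity of n. Offset 0 means that the
frequency with i = 0 is π itself. -/
lemma regDist_eq {θ : ℝ} (hθ : θ = 0 ∨ θ = Real.pi ∨ θ = -Real.pi) {n : ℕ} (hn : 0 < n) (i : ℕ) :
    regDist θ n i = 2 * Real.pi * (i + freqOffset θ n) / n := by
  have hn' : (0 : ℝ) < n := by exact_mod_cast hn
  have hpi := Real.pi_pos
  have h0 := freqOffset_nonneg θ n
  have hnn : 0 ≤ 2 * Real.pi * (i + freqOffset θ n) / n := by positivity
  rw [← abs_of_nonneg hnn, regDist, regFreq]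
  by_cases h : θ = 0
  · simp only [freqOffset, h, if_true, abs_zero, zero_sub, abs_neg]
  · have habs : |θ| = Real.pi := by
      rcases hθ.resolve_left h with rfl | rfl
      · exact abs_of_pos hpi
      · rw [abs_neg, abs_of_pos hpi]
    rw [habs]
    simp only [freqOffset, h, if_false]
    congr 1
    field_simp
    ring

/-- The `i`-th rescaled distance. -/
noncomputable def gridPt (N c : ℝ) (i : ℕ) : ℝ := (i + c) / N

lemma gridPt_mem {N c : ℝ} (hN : 0 < N) (hc0 : 0 ≤ c) (hc1 : c ≤ 1) {i : ℕ} (hi : i < ⌊N⌋₊) :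
    gridPt N c i ∈ Set.Icc (0 : ℝ) 1 := by
  refine ⟨by unfold gridPt; positivity, (div_le_one hN).2 ?_⟩
  have : (i : ℝ) + 1 ≤ ⌊N⌋₊ := by exact_mod_cast hi
  linarith [Nat.floor_le hN.le]

/-- The empirical moments of a kernel over the regression grid. -/
noncomputable def gridMoment (K : ℝ → ℝ) (N c : ℝ) (a : ℕ) : ℝ :=
  N⁻¹ * ∑ i ∈ Finset.range ⌊N⌋₊, K (gridPt N c i) * gridPt N c i ^ a

/-- The determinant of the normal equations, stripped of its powers of N and of the length 2πδ. -/
noncomputable def gridDet (K : ℝ → ℝ) (N c : ℝ) : ℝ :=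
  gridMoment K N c 0 * gridMoment K N c 4 - gridMoment K N c 2 ^ 2

/-- The weights of the local quadratic estimator. -/
noncomputable def wlsWeight (K : ℝ → ℝ) (N c : ℝ) (i : ℕ) : ℝ :=
  N⁻¹ * (K (gridPt N c i) *
    (gridMoment K N c 4 - gridMoment K N c 2 * gridPt N c i ^ 2)) * (gridDet K N c)⁻¹

/-! ### The estimator as an explicit weighted sum -/

section Algebra

variable {Ω : Type*} {m : ℕ}

lemma wlsEstimator_eq_sum_row (X : ℤ → Ω → Fin m → ℝ) (K : ℝ → ℝ) (θ δ : ℝ) (n : ℕ) (j k : Fin m)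
    (ω : Ω) :
    wlsEstimator X K θ δ n j k ω = ∑ i : Fin (numFreq δ n),
      (((designMatrix θ δ n).transpose * weightMatrix K θ δ n * designMatrix θ δ n)⁻¹ *
      (designMatrix θ δ n).transpose * weightMatrix K θ δ n) 0 i *
        (periodogram X n ω (regFreq θ n i) j k).re := by
  simp [wlsEstimator, dotProduct, Fin.sum_univ_two, Matrix.mulVec, response]

/-- Cramer's rule. It stays valid for a singular matrix, since the matrix inverse and the inverse of
the zero determinant are then both 0. -/
lemma wlsRow_eq (K : ℝ → ℝ) (θ δ : ℝ) (n : ℕ) (i : Fin (numFreq δ n)) :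
    (((designMatrix θ δ n).transpose * weightMatrix K θ δ n * designMatrix θ δ n)⁻¹ *
      (designMatrix θ δ n).transpose * weightMatrix K θ δ n) 0 i =
    ((∑ l : Fin (numFreq δ n), scaledKernel K δ (regDist θ n l)) *
        (∑ l : Fin (numFreq δ n), scaledKernel K δ (regDist θ n l) * regDist θ n l ^ 4) -
        (∑ l : Fin (numFreq δ n), scaledKernel K δ (regDist θ n l) * regDist θ n l ^ 2) ^ 2)⁻¹ *
      (((∑ l : Fin (numFreq δ n), scaledKernel K δ (regDist θ n l) * regDist θ n l ^ 4) -
        (∑ l : Fin (numFreq δ n), scaledKernel K δ (regDist θ n l) * regDist θ n l ^ 2) *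
          regDist θ n i ^ 2) * scaledKernel K δ (regDist θ n i)) := by
  have hG : (designMatrix θ δ n).transpose * weightMatrix K θ δ n * designMatrix θ δ n =
      !![∑ l : Fin (numFreq δ n), scaledKernel K δ (regDist θ n l),
         ∑ l : Fin (numFreq δ n), scaledKernel K δ (regDist θ n l) * regDist θ n l ^ 2;
         ∑ l : Fin (numFreq δ n), scaledKernel K δ (regDist θ n l) * regDist θ n l ^ 2,
         ∑ l : Fin (numFreq δ n), scaledKernel K δ (regDist θ n l) * regDist θ n l ^ 4] := by
    ext a b
    rw [Matrix.mul_apply]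
    simp only [weightMatrix, Matrix.mul_diagonal, designMatrix, Matrix.transpose_apply,
      Matrix.of_apply]
    fin_cases a <;> fin_cases b <;> simp <;> refine Finset.sum_congr rfl fun l _ => ?_ <;> ring
  rw [hG, weightMatrix, Matrix.mul_diagonal, Matrix.mul_apply, Fin.sum_univ_two,
    Matrix.inv_def, Matrix.adjugate_fin_two_of, Matrix.det_fin_two_of, Ring.inverse_eq_inv']
  simp [designMatrix]
  ring

lemma wlsEstimator_eq_sum (X : ℤ → Ω → Fin m → ℝ) (K : ℝ → ℝ) {θ δ : ℝ}
    (hθ : θ = 0 ∨ θ = Real.pi ∨ θ = -Real.pi) (hδ : 0 < δ) {n : ℕ} (hn : 0 < n) (j k : Fin m)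
    (ω : Ω) :
    wlsEstimator X K θ δ n j k ω = ∑ i ∈ Finset.range ⌊δ * n⌋₊,
      wlsWeight K (δ * n) (freqOffset θ n) i * (periodogram X n ω (regFreq θ n i) j k).re := by
  have hn' : (0 : ℝ) < n := by exact_mod_cast hn
  have hpi := Real.pi_pos
  set b := 2 * Real.pi * δ with hb
  have hbpos : 0 < b := by positivity
  set N := δ * n with hN
  have hNpos : 0 < N := by positivity
  set c := freqOffset θ n
  have hdist : ∀ i : ℕ, regDist θ n i = b * gridPt N c i := fun i => by
    rw [regDist_eq hθ hn, gridPt, hb, hN]; field_simp; rfl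
  have hker : ∀ i : ℕ, scaledKernel K δ (regDist θ n i) = b⁻¹ * K (gridPt N c i) := fun i => by
    rw [hdist, scaledKernel, ← hb, mul_div_cancel_left₀ _ hbpos.ne']
  have hT : ∀ a : ℕ, ∑ l : Fin (numFreq δ n), scaledKernel K δ (regDist θ n l) * regDist θ n l ^ a =
      b⁻¹ * b ^ a * (N * gridMoment K N c a) := fun a => by
    rw [gridMoment, mul_inv_cancel_left₀ hNpos.ne', numFreq,
      ← Finset.sum_range (fun l : ℕ => scaledKernel K δ (regDist θ n l) * regDist θ n l ^ a),
      Finset.mul_sum]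
    refine Finset.sum_congr rfl fun l _ => ?_
    rw [hker, hdist]; ring
  have hT0 : ∑ l : Fin (numFreq δ n), scaledKernel K δ (regDist θ n l) =
      b⁻¹ * (N * gridMoment K N c 0) := by simpa using hT 0
  rw [wlsEstimator_eq_sum_row, Finset.sum_range]
  refine Finset.sum_congr rfl fun i _ => ?_
  congr 1
  rw [wlsRow_eq, hT0, hT 2, hT 4, hker, hdist, wlsWeight]
  have h1 : b⁻¹ * (N * gridMoment K N c 0) * (b⁻¹ * b ^ 4 * (N * gridMoment K N c 4)) -
      (b⁻¹ * b ^ 2 * (N * gridMoment K N c 2)) ^ 2 = (b ^ 2 * N ^ 2) * gridDet K N c := by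
    rw [gridDet]; field_simp
  rw [h1, mul_inv]
  field_simp

end Algebra

/-! ### Limits of the weight sums -/

section Asymptotics

variable {K : ℝ → ℝ}

lemma exists_kernel_bound (hK : BoundedVariationOn K (Set.Icc 0 1)) :
    ∃ B, ∀ u ∈ Set.Icc (0 : ℝ) 1, |K u| ≤ B := by
  refine ⟨|K 0| + (eVariationOn K (Set.Icc 0 1)).toReal, fun u hu => ?_⟩
  have := hK.dist_le hu (show (0 : ℝ) ∈ Set.Icc (0 : ℝ) 1 by simp)
  rw [Real.dist_eq] at this
  linarith [abs_sub_abs_le_abs_sub (K u) (K 0)]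

lemma gridMoment_isBigO (hK : BoundedVariationOn K (Set.Icc 0 1)) {N c : ℕ → ℝ}
    (hN : Tendsto N atTop atTop) (hc0 : ∀ n, 0 ≤ c n) (hc1 : ∀ n, c n ≤ 1) (a : ℕ) :
    (fun n => gridMoment K (N n) (c n) a - kernelMoment K a) =O[atTop] fun n => (N n)⁻¹ := by
  obtain ⟨C, hC⟩ := exists_riemannSum_le (boundedVariationOn_kernel_mul_pow hK a)
  refine IsBigO.of_bound C ?_
  filter_upwards [hN.eventually_gt_atTop 0] with n hn
  rw [Real.norm_eq_abs, Real.norm_eq_abs, abs_of_pos (inv_pos.2 hn)]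
  exact hC (N n) (c n) hn (hc0 n) (hc1 n)

lemma gridMoment_sq_isBigO (hK : BoundedVariationOn K (Set.Icc 0 1)) {N c : ℕ → ℝ}
    (hN : Tendsto N atTop atTop) (hc0 : ∀ n, 0 ≤ c n) (hc1 : ∀ n, c n ≤ 1) (a : ℕ) :
    (fun n => gridMoment (fun u => K u ^ 2) (N n) (c n) a - kernelSqMoment K a)
      =O[atTop] fun n => (N n)⁻¹ := by
  obtain ⟨C, hC⟩ := exists_riemannSum_le (boundedVariationOn_kernelSq_mul_pow hK a)
  refine IsBigO.of_bound C ?_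
  filter_upwards [hN.eventually_gt_atTop 0] with n hn
  rw [Real.norm_eq_abs, Real.norm_eq_abs, abs_of_pos (inv_pos.2 hn)]
  exact hC (N n) (c n) hn (hc0 n) (hc1 n)

lemma gridDet_isBigO (hK : BoundedVariationOn K (Set.Icc 0 1)) {N c : ℕ → ℝ}
    (hN : Tendsto N atTop atTop) (hc0 : ∀ n, 0 ≤ c n) (hc1 : ∀ n, c n ≤ 1) :
    (fun n => gridDet K (N n) (c n) -
      (kernelMoment K 0 * kernelMoment K 4 - kernelMoment K 2 ^ 2))
      =O[atTop] fun n => (N n)⁻¹ := by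
  have he : Tendsto (fun n => (N n)⁻¹) atTop (𝓝 0) := hN.inv_tendsto_atTop
  have hS := gridMoment_isBigO hK hN hc0 hc1
  refine ((isBigO_mul_sub he (hS 0) (hS 4)).sub (isBigO_mul_sub he (hS 2) (hS 2))).congr_left
    fun n => ?_
  rw [gridDet]; ring

/-- For a = 0 the numerator is the determinant, for a = 2 it vanishes, and a = 4 leads to the bias
constant. -/
lemma sum_wlsWeight_mul_pow (K : ℝ → ℝ) (N c : ℝ) (a : ℕ) :
    ∑ i ∈ Finset.range ⌊N⌋₊, wlsWeight K N c i * gridPt N c i ^ a =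
      (gridMoment K N c 4 * gridMoment K N c a -
        gridMoment K N c 2 * gridMoment K N c (a + 2)) * (gridDet K N c)⁻¹ := by
  have h : ∀ i, wlsWeight K N c i * gridPt N c i ^ a =
      (gridMoment K N c 4 * (N⁻¹ * (K (gridPt N c i) * gridPt N c i ^ a)) -
        gridMoment K N c 2 * (N⁻¹ * (K (gridPt N c i) * gridPt N c i ^ (a + 2)))) *
          (gridDet K N c)⁻¹ := fun i => by rw [wlsWeight]; ring
  simp only [h]
  rw [← Finset.sum_mul, Finset.sum_sub_distrib, ← Finset.mul_sum, ← Finset.mul_sum,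
    ← Finset.mul_sum, ← Finset.mul_sum]
  rfl

lemma sum_wlsWeight (K : ℝ → ℝ) {N c : ℝ} (hD : gridDet K N c ≠ 0) :
    ∑ i ∈ Finset.range ⌊N⌋₊, wlsWeight K N c i = 1 := by
  have := sum_wlsWeight_mul_pow K N c 0
  simp only [pow_zero, mul_one, zero_add] at this
  rw [this, show gridMoment K N c 4 * gridMoment K N c 0 - gridMoment K N c 2 * gridMoment K N c 2 =
    gridDet K N c by rw [gridDet]; ring, mul_inv_cancel₀ hD]

lemma sum_wlsWeight_mul_sq (K : ℝ → ℝ) (N c : ℝ) :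
    ∑ i ∈ Finset.range ⌊N⌋₊, wlsWeight K N c i * gridPt N c i ^ 2 = 0 := by
  rw [sum_wlsWeight_mul_pow]; ring

lemma mul_sum_wlsWeight_sq (K : ℝ → ℝ) {N c : ℝ} (hN : 0 < N) :
    N * ∑ i ∈ Finset.range ⌊N⌋₊, wlsWeight K N c i ^ 2 =
      (gridMoment K N c 4 * gridMoment K N c 4 * gridMoment (fun u => K u ^ 2) N c 0
        - 2 * (gridMoment K N c 4 * gridMoment K N c 2 * gridMoment (fun u => K u ^ 2) N c 2)
        + gridMoment K N c 2 * gridMoment K N c 2 * gridMoment (fun u => K u ^ 2) N c 4) *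
      ((gridDet K N c)⁻¹ * (gridDet K N c)⁻¹) := by
  have h : ∀ i, N * wlsWeight K N c i ^ 2 =
      (gridMoment K N c 4 * gridMoment K N c 4 * (N⁻¹ * (K (gridPt N c i) ^ 2 * gridPt N c i ^ 0))
        - 2 * (gridMoment K N c 4 * gridMoment K N c 2 *
          (N⁻¹ * (K (gridPt N c i) ^ 2 * gridPt N c i ^ 2)))
        + gridMoment K N c 2 * gridMoment K N c 2 *
          (N⁻¹ * (K (gridPt N c i) ^ 2 * gridPt N c i ^ 4))) *
      ((gridDet K N c)⁻¹ * (gridDet K N c)⁻¹) := fun i => by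
    rw [wlsWeight]
    have : N * N⁻¹ = 1 := mul_inv_cancel₀ hN.ne'
    linear_combination (N⁻¹ * (K (gridPt N c i) *
      (gridMoment K N c 4 - gridMoment K N c 2 * gridPt N c i ^ 2)) ^ 2 *
      ((gridDet K N c)⁻¹ * (gridDet K N c)⁻¹)) * this
  rw [Finset.mul_sum, Finset.sum_congr rfl fun i _ => h i, ← Finset.sum_mul,
    Finset.sum_add_distrib, Finset.sum_sub_distrib]
  simp only [← Finset.mul_sum]
  rfl

/-- The asymptotic behaviour of the regression weights. -/
lemma wlsWeight_asymptotics (hK0 : ∀ u ∈ Set.Icc (0 : ℝ) 1, 0 ≤ K u)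
    (hKpos : 0 < ∫ u in (0 : ℝ)..1, K u) (hK : BoundedVariationOn K (Set.Icc 0 1)) {N c : ℕ → ℝ}
    (hN : Tendsto N atTop atTop) (hc0 : ∀ n, 0 ≤ c n) (hc1 : ∀ n, c n ≤ 1) :
    (∀ᶠ n in atTop, gridDet K (N n) (c n) ≠ 0) ∧
    (∃ C, 0 ≤ C ∧ ∀ᶠ n in atTop, ∀ i ∈ Finset.range ⌊N n⌋₊,
      |wlsWeight K (N n) (c n) i| ≤ C * (N n)⁻¹) ∧
    ((fun n => ∑ i ∈ Finset.range ⌊N n⌋₊, wlsWeight K (N n) (c n) i * gridPt (N n) (c n) i ^ 4 -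
      biasConst K) =O[atTop] fun n => (N n)⁻¹) ∧
    ((fun n => N n * ∑ i ∈ Finset.range ⌊N n⌋₊, wlsWeight K (N n) (c n) i ^ 2 - varConst K)
      =O[atTop] fun n => (N n)⁻¹) := by
  have he : Tendsto (fun n => (N n)⁻¹) atTop (𝓝 0) := hN.inv_tendsto_atTop
  have hS := gridMoment_isBigO hK hN hc0 hc1
  have hQ := gridMoment_sq_isBigO hK hN hc0 hc1
  have hdet := kernelMoment_det_pos hK0 hKpos hK
  have hD := gridDet_isBigO hK hN hc0 hc1
  have hDinv := isBigO_inv_sub hdet.ne' he hD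
  have htend : ∀ {x : ℕ → ℝ} {a : ℝ}, (fun n => x n - a) =O[atTop] (fun n => (N n)⁻¹) →
      Tendsto x atTop (𝓝 a) := fun {x a} h => by
    simpa using (h.trans_tendsto he).add_const a
  refine ⟨(htend hD).eventually_ne hdet.ne', ?_, ?_, ?_⟩
  · obtain ⟨B, hB⟩ := exists_kernel_bound hK
    have hB0 : 0 ≤ B := (abs_nonneg _).trans (hB 0 (by simp))
    have hlim := (((htend (hS 4)).abs.add (htend (hS 2)).abs).const_mul B).mul (htend hDinv).abs
    obtain ⟨A, hA⟩ := hlim.eventually_le_const (lt_add_one _) |>.exists_forall_of_atTop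
    -- The limit of the upper bound for N|ω_i|, plus 1 so that the bound holds eventually.
    refine ⟨max (B * (|kernelMoment K 4| + |kernelMoment K 2|) *
      |(kernelMoment K 0 * kernelMoment K 4 - kernelMoment K 2 ^ 2)⁻¹| + 1) 0, le_max_right _ _, ?_⟩
    filter_upwards [eventually_ge_atTop A, hN.eventually_gt_atTop 0] with n hn hNn i hi
    have hu := gridPt_mem hNn (hc0 n) (hc1 n) (Finset.mem_range.1 hi)
    set u := gridPt (N n) (c n) i with hu_def
    have hu2 : |u ^ 2| ≤ 1 := by
      rw [abs_of_nonneg (sq_nonneg _)]; exact pow_le_one₀ hu.1 hu.2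
    rw [wlsWeight, ← hu_def, abs_mul, abs_mul, abs_mul, abs_of_pos (inv_pos.2 hNn)]
    have h1 : |gridMoment K (N n) (c n) 4 - gridMoment K (N n) (c n) 2 * u ^ 2| ≤
        |gridMoment K (N n) (c n) 4| + |gridMoment K (N n) (c n) 2| := by
      refine (abs_sub _ _).trans (add_le_add_right ?_ _)
      rw [abs_mul]
      exact mul_le_of_le_one_right (abs_nonneg _) hu2
    calc _ = |K u| * |gridMoment K (N n) (c n) 4 - gridMoment K (N n) (c n) 2 * u ^ 2| *
          |(gridDet K (N n) (c n))⁻¹| * (N n)⁻¹ := by ring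
      _ ≤ B * (|gridMoment K (N n) (c n) 4| + |gridMoment K (N n) (c n) 2|) *
          |(gridDet K (N n) (c n))⁻¹| * (N n)⁻¹ := by
          gcongr
          exact hB u hu
      _ ≤ _ := by
          gcongr
          exact (hA n hn).trans (le_max_left _ _)
  · have h := isBigO_mul_sub he ((isBigO_mul_sub he (hS 4) (hS 4)).sub
      (isBigO_mul_sub he (hS 2) (hS 6)) |>.congr_left fun n => by
        rw [sub_sub_sub_comm]) hDinv
    refine h.congr_left fun n => ?_
    rw [sum_wlsWeight_mul_pow, biasConst]
    ring
  · have h1 := isBigO_mul_sub he (isBigO_mul_sub he (hS 4) (hS 4)) (hQ 0)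
    have h2 := isBigO_mul_sub he (isBigO_mul_sub he (hS 4) (hS 2)) (hQ 2)
    have h3 := isBigO_mul_sub he (isBigO_mul_sub he (hS 2) (hS 2)) (hQ 4)
    have h4 := (h1.sub (h2.const_mul_left 2)).add h3
    have h5 := isBigO_mul_sub he (h4.congr_left (f₂ := fun n =>
      (gridMoment K (N n) (c n) 4 * gridMoment K (N n) (c n) 4 *
        gridMoment (fun u => K u ^ 2) (N n) (c n) 0
        - 2 * (gridMoment K (N n) (c n) 4 * gridMoment K (N n) (c n) 2 *
          gridMoment (fun u => K u ^ 2) (N n) (c n) 2)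
        + gridMoment K (N n) (c n) 2 * gridMoment K (N n) (c n) 2 *
          gridMoment (fun u => K u ^ 2) (N n) (c n) 4) -
      (kernelMoment K 4 * kernelMoment K 4 * kernelSqMoment K 0
        - 2 * (kernelMoment K 4 * kernelMoment K 2 * kernelSqMoment K 2)
        + kernelMoment K 2 * kernelMoment K 2 * kernelSqMoment K 4)) fun n => by ring)
      (isBigO_mul_sub he hDinv hDinv)
    refine h5.congr' ?_ EventuallyEq.rfl
    filter_upwards [hN.eventually_gt_atTop 0] with n hn
    rw [mul_sum_wlsWeight_sq K hn, varConst, div_eq_mul_inv, ← inv_pow]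
    ring

end Asymptotics

end Weights

/-! ### Frequency indices and symmetry of the spectral density -/

section FrequencyIndices

/-- The index `s` of the `i`-th regression frequency `2πs/n`. -/
noncomputable def freqIdx (θ : ℝ) (n i : ℕ) : ℤ :=
  if θ = 0 then (i : ℤ) + 1 else ((n / 2 : ℕ) : ℤ) - i

lemma regFreq_eq (θ : ℝ) (n i : ℕ) : regFreq θ n i = 2 * Real.pi * (freqIdx θ n i : ℝ) / n := by
  unfold regFreq freqIdx
  split_ifs <;> push_cast <;> rfl

/-- All indices lie in [1, n/2], so no index is divisible by n, and neither is the sum or difference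
of two distinct ones. Only i = 0 can satisfy 2s = n. -/
lemma freqIdx_bounds (θ : ℝ) {n M i : ℕ} (hM : 4 * M ≤ n) (hi : i < M) :
    1 ≤ freqIdx θ n i ∧ 2 * freqIdx θ n i ≤ n ∧ (i ≠ 0 → 2 * freqIdx θ n i < n) := by
  unfold freqIdx
  split_ifs <;> omega

lemma freqIdx_injective (θ : ℝ) {n i l : ℕ} (h : freqIdx θ n i = freqIdx θ n l) : i = l := by
  unfold freqIdx at h
  split_ifs at h <;> omega

lemma not_dvd_of_pos_of_lt {n q : ℤ} (h0 : 0 < q) (h1 : q < n) : ¬ n ∣ q :=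
  fun h => absurd (Int.le_of_dvd h0 h) (not_le.2 h1)

variable {Ω : Type*} [MeasurableSpace Ω] {m : ℕ} {X : ℤ → Ω → Fin m → ℝ} {P : Measure Ω}

/-- The spectral density is Hermitian-symmetric about each of the points `0, ±π`. -/
lemma specDensity_reflect (X : ℤ → Ω → Fin m → ℝ) (P : Measure Ω) {θ : ℝ}
    (hθ : θ = 0 ∨ θ = Real.pi ∨ θ = -Real.pi) (x : ℝ) (j k : Fin m) :
    specDensity X P (θ - x) j k = (starRingEnd ℂ) (specDensity X P (θ + x) j k) := by
  rcases hθ with rfl | rfl | rfl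
  · rw [zero_sub, zero_add, specDensity_neg]
  · rw [← specDensity_neg, ← specDensity_add_two_pi X P (-(Real.pi + x))]
    congr 1; ring
  · rw [← specDensity_neg, ← specDensity_add_two_pi X P (-Real.pi - x)]
    congr 1; ring

lemma specDensity_im_eq_zero (X : ℤ → Ω → Fin m → ℝ) (P : Measure Ω) {θ : ℝ}
    (hθ : θ = 0 ∨ θ = Real.pi ∨ θ = -Real.pi) (j k : Fin m) :
    (specDensity X P θ j k).im = 0 := by
  have := specDensity_reflect X P hθ 0 j k
  rw [sub_zero, add_zero] at this
  exact Complex.conj_eq_iff_im.1 this.symm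

/-- Near ±π the frequency used is π - d, whose value is the conjugate of the one at θ + d by
reflection and periodicity. Neither the real part nor `asympVar` sees the conjugation. -/
lemma specDensity_regFreq (X : ℤ → Ω → Fin m → ℝ) (P : Measure Ω) {θ : ℝ}
    (hθ : θ = 0 ∨ θ = Real.pi ∨ θ = -Real.pi) {n : ℕ} (hn : 0 < n) (i : ℕ) :
    (∀ j k, specDensity X P (regFreq θ n i) j k = specDensity X P (θ + regDist θ n i) j k) ∨
    (∀ j k, specDensity X P (regFreq θ n i) j k =
      (starRingEnd ℂ) (specDensity X P (θ + regDist θ n i) j k)) := by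
  have hn' : (0 : ℝ) < n := by exact_mod_cast hn
  have hd := regDist_eq hθ hn i
  by_cases h : θ = 0
  · left
    intro j k
    congr 1
    rw [hd, regFreq, freqOffset, if_pos h, if_pos h, h, zero_add]
  · right
    intro j k
    have hw : regFreq θ n i = Real.pi - regDist θ n i := by
      rw [hd, regFreq, freqOffset, if_neg h, if_neg h]
      field_simp; ring
    rw [← specDensity_reflect X P hθ, hw]
    rcases hθ.resolve_left h with rfl | rfl
    · rfl
    · rw [← specDensity_add_two_pi X P (-Real.pi - _)]
      congr 1; ring

lemma specDensity_regFreq_re (X : ℤ → Ω → Fin m → ℝ) (P : Measure Ω) {θ : ℝ}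
    (hθ : θ = 0 ∨ θ = Real.pi ∨ θ = -Real.pi) {n : ℕ} (hn : 0 < n) (i : ℕ) (j k : Fin m) :
    (specDensity X P (regFreq θ n i) j k).re = (specDensity X P (θ + regDist θ n i) j k).re := by
  rcases specDensity_regFreq X P hθ hn i with h | h <;> simp [h]

lemma asympVar_regFreq (X : ℤ → Ω → Fin m → ℝ) (P : Measure Ω) {θ : ℝ}
    (hθ : θ = 0 ∨ θ = Real.pi ∨ θ = -Real.pi) {n : ℕ} (hn : 0 < n) (i : ℕ) (j k : Fin m) :
    asympVar X P j k (regFreq θ n i) = asympVar X P j k (θ + regDist θ n i) := by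
  rcases specDensity_regFreq X P hθ hn i with h | h <;> simp [asympVar, h]

lemma contDiff_specDensity_re (hA : AssumptionA X P 4) (θ : ℝ) (j k : Fin m) :
    ContDiff ℝ 4 fun x => (specDensity X P (θ + x) j k).re :=
  (Complex.reCLM.contDiff.comp (hA j k).2).comp (contDiff_const.add contDiff_id)

lemma contDiff_specDensity_im (hA : AssumptionA X P 4) (θ : ℝ) (j k : Fin m) :
    ContDiff ℝ 4 fun x => (specDensity X P (θ + x) j k).im :=
  (Complex.imCLM.contDiff.comp (hA j k).2).comp (contDiff_const.add contDiff_id)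

/-- Imaginary parts enter only squared, so the function is even about θ and has no linear term. -/
lemma asympVar_isLittleO (hA : AssumptionA X P 4) {θ : ℝ}
    (hθ : θ = 0 ∨ θ = Real.pi ∨ θ = -Real.pi) (j k : Fin m) :
    (fun x => asympVar X P j k (θ + x) - asympVar X P j k θ) =o[𝓝 0] fun x => x := by
  have hd : ContDiff ℝ 4 fun x => asympVar X P j k (θ + x) := by
    have h1 := contDiff_specDensity_re hA θ j j
    have h2 := contDiff_specDensity_re hA θ k k
    have h3 := contDiff_specDensity_re hA θ j k
    have h4 := contDiff_specDensity_im hA θ j k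
    exact (((h1.mul h2).add (h3.pow 2)).sub (h4.pow 2)).div_const 2
  have := isLittleO_sub_of_even (g := fun x => asympVar X P j k (θ + x)) (fun x => by
    simp only [asympVar, ← sub_eq_add_neg, specDensity_reflect X P hθ, Complex.conj_re,
      Complex.conj_im, neg_sq]) (hd.differentiable (by norm_num) 0)
  simpa using this

/-- The quadratic coefficient may stay anonymous: the weights annihilate it. -/
lemma specDensity_re_taylor (hA : AssumptionA X P 4) {θ : ℝ}
    (hθ : θ = 0 ∨ θ = Real.pi ∨ θ = -Real.pi) (j k : Fin m) :
    ∃ c : ℝ, (fun x => (specDensity X P (θ + x) j k).re - ((specDensity X P θ j k).re + c * x ^ 2 +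
      iteratedDeriv 4 (fun w : ℝ => (specDensity X P w j k).re) θ / 24 * x ^ 4))
      =o[𝓝 0] fun x => x ^ 4 := by
  have h := taylor_four_of_even (g := fun x => (specDensity X P (θ + x) j k).re) (fun x => by
    rw [← sub_eq_add_neg, specDensity_reflect X P hθ, Complex.conj_re])
    (contDiff_specDensity_re hA θ j k)
  have h4 := congrFun (iteratedDeriv_comp_const_add 4
    (fun w : ℝ => (specDensity X P w j k).re) θ) 0
  simp only [add_zero] at h h4
  rw [h4] at h
  exact ⟨_, h⟩

end FrequencyIndices

/-! ### Deterministic bounds for weighted sums -/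

section FiniteSums

/-- Off-diagonal entries are small and diagonal ones are close to V₀. The entry i = 0 has its own
allowance B', since it may belong to the frequency π. -/
lemma abs_quadForm_sub_le {M : ℕ} {ω V : ℕ → ℝ} {c : ℕ → ℕ → ℝ} {V₀ A B B' η W : ℝ}
    (hA : 0 ≤ A) (hB' : 0 ≤ B') (hω : ∀ i ∈ Finset.range M, |ω i| ≤ W)
    (hoff : ∀ i ∈ Finset.range M, ∀ l ∈ Finset.range M, i ≠ l → |c i l| ≤ A)
    (hdiag : ∀ i ∈ Finset.range M, |c i i - V i| ≤ B + if i = 0 then B' else 0)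
    (hV : ∀ i ∈ Finset.range M, |V i - V₀| ≤ η) :
    |∑ i ∈ Finset.range M, ∑ l ∈ Finset.range M, ω i * ω l * c i l -
        V₀ * ∑ i ∈ Finset.range M, ω i ^ 2| ≤
      (M * W) ^ 2 * A + M * W ^ 2 * (B + η) + W ^ 2 * B' := by
  have h1 : ∑ i ∈ Finset.range M, ∑ l ∈ Finset.range M, ω i * ω l * c i l -
        V₀ * ∑ i ∈ Finset.range M, ω i ^ 2 =
      ∑ i ∈ Finset.range M, ∑ l ∈ Finset.range M,
        ω i * ω l * (c i l - if i = l then V₀ else 0) := by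
    rw [Finset.mul_sum, ← Finset.sum_sub_distrib]
    refine Finset.sum_congr rfl fun i hi => ?_
    simp only [mul_sub, Finset.sum_sub_distrib, mul_ite, mul_zero, Finset.sum_ite_eq, hi, if_true]
    ring
  have h2 : ∀ i ∈ Finset.range M, ∀ l ∈ Finset.range M,
      |ω i * ω l * (c i l - if i = l then V₀ else 0)| ≤
        W ^ 2 * (A + if i = l then B + η + (if i = 0 then B' else 0) else 0) := by
    intro i hi l hl
    have hWi := hω i hi
    have hW0 : 0 ≤ W := (abs_nonneg _).trans hWi
    rw [abs_mul, abs_mul, sq]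
    refine mul_le_mul (mul_le_mul hWi (hω l hl) (abs_nonneg _) hW0) ?_ (abs_nonneg _)
      (by positivity)
    by_cases hil : i = l
    · subst hil
      simp only [if_true]
      have e1 := hdiag i hi
      have e2 := hV i hi
      have e3 : c i i - V₀ = (c i i - V i) + (V i - V₀) := by ring
      rw [e3]
      linarith [abs_add_le (c i i - V i) (V i - V₀)]
    · simp only [hil, if_false, sub_zero, add_zero]
      exact hoff i hi l hl hil
  rw [h1]
  calc _ ≤ ∑ i ∈ Finset.range M, ∑ l ∈ Finset.range M,
        W ^ 2 * (A + if i = l then B + η + (if i = 0 then B' else 0) else 0) :=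
        (Finset.abs_sum_le_sum_abs _ _).trans (Finset.sum_le_sum fun i hi =>
          (Finset.abs_sum_le_sum_abs _ _).trans (Finset.sum_le_sum (h2 i hi)))
    _ = W ^ 2 * (M * (M * A) + (M * (B + η) + ∑ i ∈ Finset.range M, if i = 0 then B' else 0)) := by
        simp only [← Finset.mul_sum, Finset.sum_add_distrib, Finset.sum_const, Finset.card_range,
          nsmul_eq_mul]
        congr 2
        rw [← nsmul_eq_mul, ← Finset.card_range M, ← Finset.sum_const, Finset.card_range,
          ← Finset.sum_add_distrib]
        refine Finset.sum_congr rfl fun i hi => ?_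
        rw [Finset.sum_ite_eq, if_pos hi]
    _ ≤ W ^ 2 * (M * (M * A) + (M * (B + η) + B')) := by
        gcongr
        rw [Finset.sum_ite_eq']
        split_ifs
        · exact le_rfl
        · exact hB'
    _ = _ := by ring

lemma abs_sum_weight_mul_le {M : ℕ} {ω x : ℕ → ℝ} {W A : ℝ}
    (hω : ∀ i ∈ Finset.range M, |ω i| ≤ W) (hx : ∀ i ∈ Finset.range M, |x i| ≤ A) :
    |∑ i ∈ Finset.range M, ω i * x i| ≤ M * W * A := by
  calc _ ≤ ∑ i ∈ Finset.range M, W * A := by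
        refine (Finset.abs_sum_le_sum_abs _ _).trans (Finset.sum_le_sum fun i hi => ?_)
        rw [abs_mul]
        exact mul_le_mul (hω i hi) (hx i hi) (abs_nonneg _) ((abs_nonneg _).trans (hω i hi))
    _ = _ := by simp; ring

end FiniteSums

/-! ### Variance and bias of the estimator -/

section Estimator

variable {Ω : Type*} [MeasurableSpace Ω] {m : ℕ} {X : ℤ → Ω → Fin m → ℝ} {P : Measure Ω}

lemma memLp_wlsEstimator (hgauss : IsGaussianProcess X P) (K : ℝ → ℝ) (θ δ : ℝ) (n : ℕ)
    (j k : Fin m) : MemLp (wlsEstimator X K θ δ n j k) 2 P := by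
  rw [funext (wlsEstimator_eq_sum_row X K θ δ n j k)]
  exact memLp_finsetSum _ fun i _ => (memLp_periodogram_re hgauss n _ j k).const_mul _

lemma variance_wlsEstimator (hgauss : IsGaussianProcess X P) (K : ℝ → ℝ) {θ δ : ℝ}
    (hθ : θ = 0 ∨ θ = Real.pi ∨ θ = -Real.pi) (hδ : 0 < δ) {n : ℕ} (hn : 0 < n) (j k : Fin m) :
    Var[wlsEstimator X K θ δ n j k; P] =
      ∑ i ∈ Finset.range ⌊δ * n⌋₊, ∑ l ∈ Finset.range ⌊δ * n⌋₊,
        wlsWeight K (δ * n) (freqOffset θ n) i * wlsWeight K (δ * n) (freqOffset θ n) l *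
          cov[fun ω => (periodogram X n ω (regFreq θ n i) j k).re,
            fun ω => (periodogram X n ω (regFreq θ n l) j k).re; P] := by
  have := hgauss.isProbabilityMeasure
  have hm := fun (i : ℕ) => (memLp_periodogram_re hgauss n (regFreq θ n i) j k).const_mul
    (wlsWeight K (δ * n) (freqOffset θ n) i)
  rw [← covariance_self (memLp_wlsEstimator hgauss K θ δ n j k).aemeasurable,
    funext (wlsEstimator_eq_sum X K hθ hδ hn j k),
    covariance_fun_sum_fun_sum' (fun i _ => hm i) (fun i _ => hm i)]
  simp only [covariance_const_mul_left, covariance_const_mul_right]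
  refine Finset.sum_congr rfl fun i _ => Finset.sum_congr rfl fun l _ => ?_
  ring

lemma integral_wlsEstimator (hgauss : IsGaussianProcess X P) (K : ℝ → ℝ) {θ δ : ℝ}
    (hθ : θ = 0 ∨ θ = Real.pi ∨ θ = -Real.pi) (hδ : 0 < δ) {n : ℕ} (hn : 0 < n) (j k : Fin m) :
    ∫ ω, wlsEstimator X K θ δ n j k ω ∂P =
      ∑ i ∈ Finset.range ⌊δ * n⌋₊, wlsWeight K (δ * n) (freqOffset θ n) i *
          ∫ ω, (periodogram X n ω (regFreq θ n i) j k).re ∂P := by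
  have := hgauss.isProbabilityMeasure
  rw [funext (wlsEstimator_eq_sum X K hθ hδ hn j k), integral_finsetSum _ fun i _ =>
    ((memLp_periodogram_re hgauss n (regFreq θ n i) j k).integrable (by simp)).const_mul _]
  simp only [integral_const_mul]

/-- Positivity of δ is not assumed; it follows eventually from δn → ∞, and δ < 1/4 gives the last
inequality. -/
lemma eventually_bandwidth {δ : ℕ → ℝ} (hδ : Tendsto δ atTop (𝓝 0))
    (hδn : Tendsto (fun n : ℕ => δ n * n) atTop atTop) :
    ∀ᶠ n : ℕ in atTop, 0 < n ∧ 0 < δ n ∧ 0 < δ n * n ∧ 4 * ⌊δ n * n⌋₊ ≤ n := by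
  filter_upwards [eventually_gt_atTop 0, hδn.eventually_gt_atTop 0,
    hδ.eventually_lt_const (by norm_num : (0 : ℝ) < 1 / 4)] with n hn hN hd
  have hn' : (0 : ℝ) < n := by exact_mod_cast hn
  refine ⟨hn, pos_of_mul_pos_left hN hn'.le, hN, ?_⟩
  have h1 := Nat.floor_le hN.le
  have h2 : δ n * n ≤ 1 / 4 * n := by gcongr
  have h3 : (4 : ℝ) * ⌊δ n * n⌋₊ ≤ n := by linarith
  exact_mod_cast h3

lemma regDist_eq_gridPt {θ δ : ℝ} (hθ : θ = 0 ∨ θ = Real.pi ∨ θ = -Real.pi) (hδ : 0 < δ) {n : ℕ}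
    (hn : 0 < n) (i : ℕ) :
    regDist θ n i = 2 * Real.pi * δ * gridPt (δ * n) (freqOffset θ n) i := by
  have hn' : (0 : ℝ) < n := by exact_mod_cast hn
  rw [regDist_eq hθ hn, gridPt]; field_simp

lemma regDist_mem {θ δ : ℝ} (hθ : θ = 0 ∨ θ = Real.pi ∨ θ = -Real.pi) (hδ : 0 < δ) {n : ℕ}
    (hn : 0 < n) {i : ℕ} (hi : i < ⌊δ * n⌋₊) :
    0 ≤ regDist θ n i ∧ regDist θ n i ≤ 2 * Real.pi * δ := by
  have hn' : (0 : ℝ) < n := by exact_mod_cast hn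
  have hpi := Real.pi_pos
  have hu := gridPt_mem (by positivity : 0 < δ * n) (freqOffset_nonneg θ n)
    (freqOffset_le_one θ n) hi
  refine ⟨abs_nonneg _, ?_⟩
  rw [regDist_eq_gridPt hθ hδ hn]
  exact mul_le_of_le_one_right (by positivity) hu.2

/-- All distances are at most 2πδ, so statements near 0 hold uniformly over the regression
frequencies. -/
lemma eventually_regDist {δ : ℕ → ℝ} (hδ : Tendsto δ atTop (𝓝 0))
    (hδn : Tendsto (fun n : ℕ => δ n * n) atTop atTop) {θ : ℝ}
    (hθ : θ = 0 ∨ θ = Real.pi ∨ θ = -Real.pi) {p : ℝ → Prop} (hp : ∀ᶠ x in 𝓝 0, p x) :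
    ∀ᶠ n : ℕ in atTop, ∀ i ∈ Finset.range ⌊δ n * n⌋₊, p (regDist θ n i) := by
  obtain ⟨r, hr, hball⟩ := Metric.eventually_nhds_iff.1 hp
  have h0 : Tendsto (fun n => 2 * Real.pi * δ n) atTop (𝓝 0) := by
    simpa using hδ.const_mul (2 * Real.pi)
  filter_upwards [eventually_bandwidth hδ hδn, h0.eventually_lt_const hr] with n ⟨hn, hd, _, _⟩ hlt
    i hi
  obtain ⟨h1, h2⟩ := regDist_mem hθ hd hn (Finset.mem_range.1 hi)
  apply hball
  rw [Real.dist_eq, sub_zero, abs_of_nonneg h1]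
  exact h2.trans_lt hlt

lemma variance_remainder_le (hstat : IsStrictlyStationary X P)
    (hgauss : IsGaussianProcess X P) (hA : AssumptionA X P 4) {K : ℝ → ℝ}
    (hK0 : ∀ u ∈ Set.Icc (0 : ℝ) 1, 0 ≤ K u) (hKpos : 0 < ∫ u in (0 : ℝ)..1, K u)
    (hK : BoundedVariationOn K (Set.Icc 0 1)) {θ : ℝ}
    (hθ : θ = 0 ∨ θ = Real.pi ∨ θ = -Real.pi) (j k : Fin m) {δ : ℕ → ℝ}
    (hδ : Tendsto δ atTop (𝓝 0)) (hδn : Tendsto (fun n : ℕ => δ n * n) atTop atTop) :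
    ∃ C, ∀ ε > 0, ∀ᶠ n : ℕ in atTop,
      |Var[wlsEstimator X K θ (δ n) n j k; P] -
        (δ n * n)⁻¹ * asympVar X P j k θ * varConst K| ≤
      |C * ((δ n)⁻¹ ^ 2 * (n : ℝ)⁻¹ ^ 2)| + ε * |(n : ℝ)⁻¹| := by
  obtain ⟨-, ⟨C, hC0, hC⟩, -, hvar⟩ := wlsWeight_asymptotics hK0 hKpos hK hδn
    (c := freqOffset θ) (freqOffset_nonneg θ) (freqOffset_le_one θ)
  obtain ⟨Cv, hCv⟩ := hvar.bound
  set V₀ := asympVar X P j k θ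
  set R := lagMoment X P
  have hR : 0 ≤ R := lagMoment_nonneg
  set F := spectralBound X P
  have hF : 0 ≤ F := spectralBound_nonneg
  set B := R * (2 * F + R)
  have hB : 0 ≤ B := by positivity
  set B' := (F + R) ^ 2 + F ^ 2 * 2
  have hB' : 0 ≤ B' := by positivity
  have hpi := Real.pi_pos
  -- The two errors of order N⁻²: the exceptional ordinate i = 0, and the Riemann sum error in N ∑
  -- ω_i².
  refine ⟨C ^ 2 * B' + |V₀| * |Cv|, fun ε hε => ?_⟩
  have hε' : 0 < ε / (2 * (2 * Real.pi * C ^ 2 + 1)) := by positivity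
  set ε' := ε / (2 * (2 * Real.pi * C ^ 2 + 1)) with hε'_def
  have hεle : C ^ 2 * (ε' * (2 * Real.pi)) ≤ ε / 2 := by
    have : ε' * (2 * Real.pi * C ^ 2 + 1) = ε / 2 := by rw [hε'_def]; field_simp
    linarith
  -- After a factor 1/n is taken out, these are the off-diagonal covariances and the O(1/n) error of
  -- the diagonal ones; both are o(1/n).
  have hlim : Tendsto (fun n : ℕ => C ^ 2 * R ^ 2 * (n : ℝ)⁻¹ + C ^ 2 * B * (δ n * n)⁻¹)
      atTop (𝓝 0) := by
    have h1 : Tendsto (fun n : ℕ => (n : ℝ)⁻¹) atTop (𝓝 0) := tendsto_inv_atTop_nhds_zero_nat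
    simpa using (h1.const_mul (C ^ 2 * R ^ 2)).add (hδn.inv_tendsto_atTop.const_mul (C ^ 2 * B))
  filter_upwards [eventually_bandwidth hδ hδn, hC, hCv,
    hlim.eventually_le_const (by positivity : (0 : ℝ) < ε / 2),
    eventually_regDist hδ hδn hθ ((asympVar_isLittleO hA hθ j k).bound hε')]
    with n ⟨hn, hd, hN, hM⟩ hWn hvn hsmall hVn
  have hn' : (0 : ℝ) < n := by exact_mod_cast hn
  set N := δ n * n with hN_def
  set M := ⌊N⌋₊
  have hMN : (M : ℝ) ≤ N := Nat.floor_le hN.le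
  have hidx := fun i (hi : i ∈ Finset.range M) =>
    freqIdx_bounds θ (n := n) hM (Finset.mem_range.1 hi)
  have hnd := fun i (hi : i ∈ Finset.range M) =>
    not_dvd_of_pos_of_lt (n := n) (q := freqIdx θ n i) (by linarith [(hidx i hi).1])
      (by linarith [(hidx i hi).1, (hidx i hi).2.1])
  have hVbound : ∀ w, |asympVar X P j k w| ≤ F ^ 2 * 2 := by
    intro w
    have hb : ∀ j k, ‖specDensity X P w j k‖ ≤ F := fun j k => by
      have := norm_specDensity_le hA w j k
      rw [norm_mul, norm_mul, Complex.norm_real, Real.norm_eq_abs, abs_of_pos hpi,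
        Complex.norm_ofNat] at this
      refine le_trans ?_ this
      exact le_mul_of_one_le_left (norm_nonneg _) (by linarith [Real.pi_gt_three])
    have hre := fun j k => (Complex.abs_re_le_norm _).trans (hb j k)
    have him := fun j k => (Complex.abs_im_le_norm _).trans (hb j k)
    have e1 : |(specDensity X P w j j).re * (specDensity X P w k k).re| ≤ F * F := by
      rw [abs_mul]; exact mul_le_mul (hre j j) (hre k k) (abs_nonneg _) hF
    have e2 := sq_le_sq.2 ((hre j k).trans (le_abs_self F))
    have e3 := sq_le_sq.2 ((him j k).trans (le_abs_self F))
    rw [asympVar, abs_le]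
    rw [abs_le] at e1
    have := sq_nonneg (specDensity X P w j k).re
    have := sq_nonneg (specDensity X P w j k).im
    constructor <;> nlinarith
  have hmain := abs_quadForm_sub_le (M := M)
    (ω := wlsWeight K N (freqOffset θ n)) (V := fun i => asympVar X P j k (regFreq θ n i))
    (c := fun i l => cov[fun ω => (periodogram X n ω (regFreq θ n i) j k).re,
            fun ω => (periodogram X n ω (regFreq θ n l) j k).re; P])
    (V₀ := V₀) (A := R ^ 2 * (n : ℝ)⁻¹ ^ 2) (B := B * (n : ℝ)⁻¹) (B' := B')
    (η := ε' * (2 * Real.pi * δ n)) (W := C * N⁻¹) (by positivity) hB' hWn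
    (fun i hi l hl hil => by
      simp only [regFreq_eq]
      have b1 := hidx i hi
      have b2 := hidx l hl
      have hne : freqIdx θ n i ≠ freqIdx θ n l := fun h => hil (freqIdx_injective θ h)
      refine abs_covariance_periodogram_re_le_of_ne hstat hgauss hA hn (hnd i hi) (hnd l hl) ?_
        (not_dvd_of_pos_of_lt (by omega) (by omega)) j k
      rcases lt_or_gt_of_ne hne with h | h
      · rw [← dvd_neg, neg_sub]
        exact not_dvd_of_pos_of_lt (by omega) (by omega)
      · exact not_dvd_of_pos_of_lt (by omega) (by omega))
    (fun i hi => by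
      simp only [regFreq_eq]
      by_cases h0 : i = 0
      · rw [if_pos h0]
        have e1 := abs_covariance_periodogram_re_self_le hstat hgauss hA hn (hnd i hi) j k
        have e2 := hVbound (2 * Real.pi * (freqIdx θ n i : ℝ) / n)
        refine (abs_sub _ _).trans ((add_le_add e1 e2).trans ?_)
        have : 0 ≤ B * (n : ℝ)⁻¹ := by positivity
        linarith
      · rw [if_neg h0, add_zero]
        have b1 := hidx i hi
        exact abs_covariance_periodogram_re_self_sub_le hstat hgauss hA hn (hnd i hi)
          (not_dvd_of_pos_of_lt (by omega) (by have := b1.2.2 h0; omega)) j k)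
    (fun i hi => by
      have e := hVn i hi
      obtain ⟨h1, h2⟩ := regDist_mem hθ hd hn (Finset.mem_range.1 hi)
      rw [asympVar_regFreq X P hθ hn]
      rw [Real.norm_eq_abs, Real.norm_eq_abs, abs_of_nonneg h1] at e
      exact e.trans (by gcongr))
  have hW0 : 0 ≤ C * N⁻¹ := by positivity
  have hMW : M * (C * N⁻¹) ≤ C := by
    calc _ ≤ N * (C * N⁻¹) := by gcongr
      _ = C := by field_simp
  have hMW2 : M * (C * N⁻¹) ^ 2 ≤ C ^ 2 * N⁻¹ := by
    calc _ = (M * (C * N⁻¹)) * (C * N⁻¹) := by ring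
      _ ≤ C * (C * N⁻¹) := by gcongr
      _ = _ := by ring
  have hbound : (M * (C * N⁻¹)) ^ 2 * (R ^ 2 * (n : ℝ)⁻¹ ^ 2) +
      M * (C * N⁻¹) ^ 2 * (B * (n : ℝ)⁻¹ + ε' * (2 * Real.pi * δ n)) + (C * N⁻¹) ^ 2 * B' ≤
      C ^ 2 * (R ^ 2 * (n : ℝ)⁻¹ ^ 2) +
      C ^ 2 * N⁻¹ * (B * (n : ℝ)⁻¹ + ε' * (2 * Real.pi * δ n)) + (C * N⁻¹) ^ 2 * B' := by
    gcongr
  have hNd : N⁻¹ * δ n = (n : ℝ)⁻¹ := by rw [hN_def]; field_simp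
  have hNinv : N⁻¹ ^ 2 = (δ n)⁻¹ ^ 2 * (n : ℝ)⁻¹ ^ 2 := by rw [hN_def, mul_inv, mul_pow]
  have hsq : |∑ i ∈ Finset.range M, wlsWeight K N (freqOffset θ n) i ^ 2 - N⁻¹ * varConst K| ≤
      |Cv| * N⁻¹ ^ 2 := by
    have e : ∑ i ∈ Finset.range M, wlsWeight K N (freqOffset θ n) i ^ 2 - N⁻¹ * varConst K =
      N⁻¹ * (N * ∑ i ∈ Finset.range M, wlsWeight K N (freqOffset θ n) i ^ 2 - varConst K) := by
      field_simp
    rw [Real.norm_eq_abs, Real.norm_eq_abs, abs_of_pos (inv_pos.2 hN)] at hvn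
    rw [e, abs_mul, abs_of_pos (inv_pos.2 hN)]
    calc _ ≤ N⁻¹ * (Cv * N⁻¹) := by gcongr
      _ ≤ N⁻¹ * (|Cv| * N⁻¹) := by gcongr; exact le_abs_self _
      _ = _ := by ring
  rw [variance_wlsEstimator hgauss K hθ hd hn, ← hN_def]
  set Q := ∑ i ∈ Finset.range M, ∑ l ∈ Finset.range M,
        wlsWeight K N (freqOffset θ n) i * wlsWeight K N (freqOffset θ n) l *
          cov[fun ω => (periodogram X n ω (regFreq θ n i) j k).re,
            fun ω => (periodogram X n ω (regFreq θ n l) j k).re; P]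
  set S := ∑ i ∈ Finset.range M, wlsWeight K N (freqOffset θ n) i ^ 2
  have hfin : Q - N⁻¹ * V₀ * varConst K = (Q - V₀ * S) + V₀ * (S - N⁻¹ * varConst K) := by ring
  have hlast : |V₀ * (S - N⁻¹ * varConst K)| ≤ |V₀| * (|Cv| * N⁻¹ ^ 2) := by
    rw [abs_mul]; gcongr
  have hs2 := mul_le_mul_of_nonneg_right hsmall (inv_nonneg.2 hn'.le)
  have hs3 := mul_le_mul_of_nonneg_right hεle (inv_nonneg.2 hn'.le)
  rw [hfin, abs_of_nonneg (by positivity : 0 ≤ (C ^ 2 * B' + |V₀| * |Cv|) *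
    ((δ n)⁻¹ ^ 2 * (n : ℝ)⁻¹ ^ 2)), abs_of_nonneg (inv_nonneg.2 hn'.le), ← hNinv]
  calc _ ≤ _ := abs_add_le _ _
    _ ≤ _ := add_le_add (hmain.trans hbound) hlast
    _ = (C ^ 2 * B' + |V₀| * |Cv|) * N⁻¹ ^ 2 + ((C ^ 2 * R ^ 2 * (n : ℝ)⁻¹ + C ^ 2 * B * N⁻¹) *
          (n : ℝ)⁻¹ + C ^ 2 * (ε' * (2 * Real.pi)) * (N⁻¹ * δ n)) := by ring
    _ ≤ (C ^ 2 * B' + |V₀| * |Cv|) * N⁻¹ ^ 2 + (ε / 2 * (n : ℝ)⁻¹ + ε / 2 * (n : ℝ)⁻¹) := by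
        rw [hNd]; gcongr
    _ = _ := by ring

lemma bias_remainder_le (hstat : IsStrictlyStationary X P)
    (hgauss : IsGaussianProcess X P) (hA : AssumptionA X P 4) {K : ℝ → ℝ}
    (hK0 : ∀ u ∈ Set.Icc (0 : ℝ) 1, 0 ≤ K u) (hKpos : 0 < ∫ u in (0 : ℝ)..1, K u)
    (hK : BoundedVariationOn K (Set.Icc 0 1)) {θ : ℝ}
    (hθ : θ = 0 ∨ θ = Real.pi ∨ θ = -Real.pi) (j k : Fin m) {δ : ℕ → ℝ}
    (hδ : Tendsto δ atTop (𝓝 0)) (hδn : Tendsto (fun n : ℕ => δ n * n) atTop atTop) :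
    ∃ C, ∀ ε > 0, ∀ᶠ n : ℕ in atTop,
      |∫ ω, wlsEstimator X K θ (δ n) n j k ω ∂P - (specDensity X P θ j k).re -
        iteratedDeriv 4 (fun w : ℝ => (specDensity X P w j k).re) θ / 24 *
          (2 * Real.pi * δ n) ^ 4 * biasConst K| ≤
      |C * (n : ℝ)⁻¹| + ε * |δ n ^ 4| := by
  obtain ⟨hdet, ⟨C, hC0, hC⟩, hbias, -⟩ := wlsWeight_asymptotics hK0 hKpos hK hδn
    (c := freqOffset θ) (freqOffset_nonneg θ) (freqOffset_le_one θ)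
  obtain ⟨Cb, hCb⟩ := hbias.bound
  obtain ⟨c₂, htaylor⟩ := specDensity_re_taylor hA hθ j k
  set f₀ := (specDensity X P θ j k).re
  set c₄ := iteratedDeriv 4 (fun w : ℝ => (specDensity X P w j k).re) θ / 24
  set R := lagMoment X P
  have hR : 0 ≤ R := lagMoment_nonneg
  have hpi := Real.pi_pos
  refine ⟨C * R, fun ε hε => ?_⟩
  have hε' : 0 < ε / (2 * ((2 * Real.pi) ^ 4 * C + 1)) := by positivity
  set ε' := ε / (2 * ((2 * Real.pi) ^ 4 * C + 1)) with hε'_def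
  have hεle : C * ε' * (2 * Real.pi) ^ 4 ≤ ε / 2 := by
    have : ε' * ((2 * Real.pi) ^ 4 * C + 1) = ε / 2 := by rw [hε'_def]; field_simp
    linarith
  have hlim : Tendsto (fun n : ℕ => |c₄| * (2 * Real.pi) ^ 4 * |Cb| * (δ n * n)⁻¹)
      atTop (𝓝 0) := by
    simpa using hδn.inv_tendsto_atTop.const_mul (|c₄| * (2 * Real.pi) ^ 4 * |Cb|)
  filter_upwards [eventually_bandwidth hδ hδn, hdet, hC, hCb,
    hlim.eventually_le_const (by positivity : (0 : ℝ) < ε / 2),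
    eventually_regDist hδ hδn hθ (htaylor.bound hε')]
    with n ⟨hn, hd, hN, hM⟩ hdn hWn hbn hsmall hTn
  have hn' : (0 : ℝ) < n := by exact_mod_cast hn
  set N := δ n * n with hN_def
  set M := ⌊N⌋₊
  have hMN : (M : ℝ) ≤ N := Nat.floor_le hN.le
  have hidx := fun i (hi : i ∈ Finset.range M) =>
    freqIdx_bounds θ (n := n) hM (Finset.mem_range.1 hi)
  have hMW : M * (C * N⁻¹) ≤ C := by
    calc _ ≤ N * (C * N⁻¹) := by gcongr
      _ = C := by field_simp
  set ω := wlsWeight K N (freqOffset θ n)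
  set b := 2 * Real.pi * δ n with hb_def
  have hb : 0 ≤ b := by positivity
  set T : ℝ → ℝ := fun x => f₀ + c₂ * x ^ 2 + c₄ * x ^ 4
  have h1 := abs_sum_weight_mul_le hWn (x := fun i =>
      ∫ ω, (periodogram X n ω (regFreq θ n i) j k).re ∂P -
        (specDensity X P (regFreq θ n i) j k).re) (A := R * (n : ℝ)⁻¹) (fun i hi => by
    rw [regFreq_eq]
    have b1 := hidx i hi
    exact abs_integral_periodogram_re_sub_le hstat hgauss hA hn
      (not_dvd_of_pos_of_lt (by omega) (by omega)) j k)
  have h2 := abs_sum_weight_mul_le hWn (x := fun i =>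
      (specDensity X P (regFreq θ n i) j k).re - T (regDist θ n i)) (A := ε' * b ^ 4)
      (fun i hi => by
    rw [specDensity_regFreq_re X P hθ hn]
    obtain ⟨h1, h2⟩ := regDist_mem hθ hd hn (Finset.mem_range.1 hi)
    have e := hTn i hi
    rw [Real.norm_eq_abs, Real.norm_eq_abs, abs_of_nonneg (pow_nonneg h1 4)] at e
    exact e.trans (by gcongr))
  -- The weights sum to 1 and annihilate squares, so averaging the Taylor polynomial is exact up to
  -- the fourth moment of the weights.
  have h3 : ∑ i ∈ Finset.range M, ω i * T (regDist θ n i) =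
      f₀ + c₄ * b ^ 4 * ∑ i ∈ Finset.range M, ω i * gridPt N (freqOffset θ n) i ^ 4 := by
    have e : ∀ i, ω i * T (regDist θ n i) = f₀ * ω i +
        c₂ * b ^ 2 * (ω i * gridPt N (freqOffset θ n) i ^ 2) +
        c₄ * b ^ 4 * (ω i * gridPt N (freqOffset θ n) i ^ 4) := fun i => by
      simp only [T]
      rw [regDist_eq_gridPt hθ hd hn]; ring
    simp only [e, Finset.sum_add_distrib, ← Finset.mul_sum]
    rw [sum_wlsWeight K hdn, sum_wlsWeight_mul_sq]
    ring
  have h4 : |c₄ * b ^ 4 * (∑ i ∈ Finset.range M, ω i * gridPt N (freqOffset θ n) i ^ 4 -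
      biasConst K)| ≤ |c₄| * b ^ 4 * (|Cb| * N⁻¹) := by
    rw [Real.norm_eq_abs, Real.norm_eq_abs, abs_of_pos (inv_pos.2 hN)] at hbn
    rw [abs_mul, abs_mul, abs_of_nonneg (pow_nonneg hb 4)]
    have : Cb * N⁻¹ ≤ |Cb| * N⁻¹ := by gcongr; exact le_abs_self _
    exact mul_le_mul_of_nonneg_left (hbn.trans this) (by positivity)
  rw [integral_wlsEstimator hgauss K hθ hd hn]
  -- Three errors: the bias of the periodogram, O(1/n); the Taylor remainder, o(δ⁴); the error of
  -- the fourth weight moment, O(δ⁴/N) = o(δ⁴).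
  have hdecomp : ∑ i ∈ Finset.range M, ω i *
        ∫ ω, (periodogram X n ω (regFreq θ n i) j k).re ∂P - f₀ - c₄ * b ^ 4 * biasConst K =
      ∑ i ∈ Finset.range M, ω i * (∫ ω, (periodogram X n ω (regFreq θ n i) j k).re ∂P -
        (specDensity X P (regFreq θ n i) j k).re) +
      ∑ i ∈ Finset.range M, ω i * ((specDensity X P (regFreq θ n i) j k).re -
        T (regDist θ n i)) +
      c₄ * b ^ 4 * (∑ i ∈ Finset.range M, ω i * gridPt N (freqOffset θ n) i ^ 4 -
        biasConst K) := by
    have e : ∑ i ∈ Finset.range M, ω i *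
        ∫ ω, (periodogram X n ω (regFreq θ n i) j k).re ∂P =
      ∑ i ∈ Finset.range M, ω i * (∫ ω, (periodogram X n ω (regFreq θ n i) j k).re ∂P -
        (specDensity X P (regFreq θ n i) j k).re) +
      ∑ i ∈ Finset.range M, ω i * ((specDensity X P (regFreq θ n i) j k).re -
        T (regDist θ n i)) + ∑ i ∈ Finset.range M, ω i * T (regDist θ n i) := by
      rw [← Finset.sum_add_distrib, ← Finset.sum_add_distrib]
      exact Finset.sum_congr rfl fun i _ => by ring
    rw [e, h3]; ring
  have hd4 : 0 ≤ δ n ^ 4 := by positivity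
  have hs1 := mul_le_mul_of_nonneg_right hεle hd4
  have hs2 := mul_le_mul_of_nonneg_right hsmall hd4
  rw [hdecomp, abs_of_nonneg (by positivity : 0 ≤ C * R * (n : ℝ)⁻¹), abs_of_nonneg hd4]
  calc _ ≤ _ := (abs_add_le _ _).trans (add_le_add (abs_add_le _ _) le_rfl)
    _ ≤ M * (C * N⁻¹) * (R * (n : ℝ)⁻¹) + M * (C * N⁻¹) * (ε' * b ^ 4) +
        |c₄| * b ^ 4 * (|Cb| * N⁻¹) := add_le_add (add_le_add h1 h2) h4
    _ ≤ C * (R * (n : ℝ)⁻¹) + C * (ε' * b ^ 4) + |c₄| * b ^ 4 * (|Cb| * N⁻¹) := by gcongr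
    _ = C * R * (n : ℝ)⁻¹ + (C * ε' * (2 * Real.pi) ^ 4 * δ n ^ 4 +
        |c₄| * (2 * Real.pi) ^ 4 * |Cb| * N⁻¹ * δ n ^ 4) := by rw [hb_def]; ring
    _ ≤ C * R * (n : ℝ)⁻¹ + (ε / 2 * δ n ^ 4 + ε / 2 * δ n ^ 4) := by gcongr
    _ = _ := by ring

end Estimator

end LocalQuadratic

/-! ### The variance and bias expansions -/

theorem proposition4p2 {Ω : Type*} [MeasurableSpace Ω] (P : Measure Ω) [IsProbabilityMeasure P]
    {m : ℕ} (X : ℤ → Ω → Fin m → ℝ)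
    (hstat : LocalQuadratic.IsStrictlyStationary X P)
    (hgauss : IsGaussianProcess X P)
    (hA : LocalQuadratic.AssumptionA X P 4)
    (K : ℝ → ℝ) (hK_nonneg : ∀ u ∈ Set.Icc (0 : ℝ) 1, 0 ≤ K u)
    (hK_pos : 0 < ∫ u in (0 : ℝ)..1, K u)
    (hK_bv : BoundedVariationOn K (Set.Icc 0 1))
    (θ : ℝ) (hθ : θ = 0 ∨ θ = Real.pi ∨ θ = -Real.pi) (j k : Fin m)
    (δ : ℕ → ℝ) (hδ : Tendsto δ atTop (𝓝 0))
    (hδn : Tendsto (fun n : ℕ => δ n * n) atTop atTop) :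
    (∀ n : ℕ, MemLp (LocalQuadratic.wlsEstimator X K θ (δ n) n j k) 2 P) ∧
    (∃ r₁ r₂ : ℕ → ℝ,
      r₁ =O[atTop] (fun n : ℕ => (δ n)⁻¹ ^ 2 * (n : ℝ)⁻¹ ^ 2) ∧
      r₂ =o[atTop] (fun n : ℕ => (n : ℝ)⁻¹) ∧
      ∀ n : ℕ,
        ((Var[LocalQuadratic.wlsEstimator X K θ (δ n) n j k; P] : ℝ) : ℂ) =
          (((δ n)⁻¹ * (n : ℝ)⁻¹ : ℝ) : ℂ) *
            ((LocalQuadratic.specDensity X P θ j k ^ 2 + LocalQuadratic.specDensity X P θ k j ^ 2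
              + 2 * LocalQuadratic.specDensity X P θ j j * LocalQuadratic.specDensity X P θ k k)
              / 4) * (LocalQuadratic.varConst K : ℂ)
            + (r₁ n : ℂ) + (r₂ n : ℂ)) ∧
    (∃ r₃ r₄ : ℕ → ℝ,
      r₃ =o[atTop] (fun n : ℕ => δ n ^ 4) ∧
      r₄ =O[atTop] (fun n : ℕ => (n : ℝ)⁻¹) ∧
      ∀ n : ℕ,
        ((∫ ω, LocalQuadratic.wlsEstimator X K θ (δ n) n j k ω ∂P : ℝ) : ℂ)
            - LocalQuadratic.specDensity X P θ j k =
          ((iteratedDeriv 4 (fun w : ℝ => (LocalQuadratic.specDensity X P w j k).re) θ / 24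
              * (2 * Real.pi * δ n) ^ 4 * LocalQuadratic.biasConst K : ℝ) : ℂ)
            + (r₃ n : ℂ) + (r₄ n : ℂ)) := by
  -- The spectral density is real at θ, so both complex identities reduce to real ones.
  have hre : ∀ a b, LocalQuadratic.specDensity X P θ a b =
      ((LocalQuadratic.specDensity X P θ a b).re : ℂ) := fun a b =>
    Complex.ext rfl (by rw [LocalQuadratic.specDensity_im_eq_zero X P hθ, Complex.ofReal_im])
  refine ⟨fun n => LocalQuadratic.memLp_wlsEstimator hgauss K θ (δ n) n j k, ?_, ?_⟩
  · obtain ⟨C, hC⟩ := LocalQuadratic.variance_remainder_le hstat hgauss hA hK_nonneg hK_pos hK_bv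
      hθ j k hδ hδn
    obtain ⟨r₁, r₂, h₁, h₂, h⟩ := LocalQuadratic.exists_isBigO_add_isLittleO hC
      ((isBigO_refl _ _).const_mul_left C)
    refine ⟨r₁, r₂, h₁, h₂, fun n => ?_⟩
    -- With real entries f_kj = f_jk, and V(θ) = (f_jj f_kk + f_jk²)/2 takes the symmetric form with
    -- denominator 4.
    have hswap : (LocalQuadratic.specDensity X P θ k j).re =
        (LocalQuadratic.specDensity X P θ j k).re := by
      rw [LocalQuadratic.specDensity_swap hstat, Complex.conj_re]
    have hn := h n
    rw [LocalQuadratic.asympVar, LocalQuadratic.specDensity_im_eq_zero X P hθ] at hn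
    rw [hre j k, hre k j, hre j j, hre k k, hswap]
    norm_cast
    rw [mul_inv] at hn
    linear_combination hn
  · obtain ⟨C, hC⟩ := LocalQuadratic.bias_remainder_le hstat hgauss hA hK_nonneg hK_pos hK_bv
      hθ j k hδ hδn
    obtain ⟨r₄, r₃, h₄, h₃, h⟩ := LocalQuadratic.exists_isBigO_add_isLittleO hC
      ((isBigO_refl _ _).const_mul_left C)
    refine ⟨r₃, r₄, h₃, h₄, fun n => ?_⟩
    rw [hre j k]
    norm_cast
    linear_combination h n
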